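/- **Setting.** A pairing of a finite set $K$ is a partition of $K$ into two-element sets. A pairing structure $\mathcal T$ with index set $K$ represents a set $S(\mathcal T)$ of pairings of $K$ and is one of: a base structure, $K=\{i,j\}$ with $i\ne j$ and $S(\mathcal T)=\{\{\{i,j\}\}\}$; a union $\mathcal T_1\cup\mathcal T_2$ of structures on the same index set $K$ with $S(\mathcal T_1)\cap S(\mathcal T_2)=\emptyset$, with $S(\mathcal T)=S(\mathcal T_1)\cup S(\mathcal T_2)$; a product $\mathcal T_1\otimes\mathcal T_2$ of structures on disjoint index sets $K_1,K_2$, with $K=K_1\cup K_2$ and $S(\mathcal T)=\{p_1\cup p_2: p_i\in S(\mathcal T_i)\}$. Its representation size is its number of nodes (base structures, unions and products). Let $\Sigma$ be a random positive semidefinite symmetric $n\times n$ matrix whose off-diagonal entries are independent $\mathcal N(0,1)$ variables, let $Y=\mathrm{haf}(\Sigma)=\sum_p\prod_{\{i,j\}\in p}\Sigma_{ij}$ (sum over all pairings $p$ of $[n]$), and for a pairing structure $\mathcal T$ with index set $[n]$ let $X_{\mathcal T}=\sum_{p\in S(\mathcal T)}\prod_{\{i,j\}\in p}\Sigma_{ij}$.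 For square-integrable $X,f$, say that $f$ is $(\varepsilon,X)$-accurate if $\mathbb E[(Y-f)X]^2\le\varepsilon^2\,\mathbb E[X^2]\,\mathbb E[f^2]$. **Algorithm ESTIMATOR** (input $\mathcal T_1,\dots,\mathcal T_m,\delta,\varepsilon$). Let $D=\mathrm{diag}(d)$, $d_i=\sqrt{|S(\mathcal T_i)|}$, where $|S(\mathcal T)|$ is computed recursively by $\text{NumPairings}$. In rounds $s=1,2,\dots$: for every $i<j$ draw a fresh random pairing from $S(\mathcal T_j)$ by $\text{Sample}$ and test by $\text{Contains}$ whether it belongs to $S(\mathcal T_i)$; let $M_{ij}=M_{ji}$ be the number of successful tests so far and $M_{ii}=s$; let $\hat C$ be the symmetric matrix with $\hat C_{ij}=d_i^{-1}M_{ij}d_j/s$ for $i\le j$, and let $\hat\sigma_m$ be its least singular value. Stop as soon as $\hat\sigma_m>0$ and $s\ge 80m^2(m^2+3\ln(2/\delta))/(\varepsilon^2\hat\sigma_m^4)$, and return $f=\beta^\top(X_{\mathcal T_1},\dots,X_{\mathcal T_m})$ with $\beta=D^{-1}\hat C^{-1}d$. $\text{Sample}$ returns the pair of a base structure; on a product it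 returns the union of samples of the two factors; on a union it draws $r$ uniformly from $[0,1)$ and samples $\mathcal T_1$ if $r<|S(\mathcal T_1)|/|S(\mathcal T)|$ and $\mathcal T_2$ otherwise. $\text{Contains}(\mathcal T,p)$ returns true on a base structure; on a product it returns false if some pair of $p$ meets $K_1$ in exactly one point, and otherwise tests the pairs inside $K_1$ against $\mathcal T_1$ and the others against $\mathcal T_2$; on a union it tests $p$ against $\mathcal T_1$ and, if this fails, against $\mathcal T_2$. **Cost model.** Each arithmetic operation on real numbers (including $\sqrt{\ }$ and $\ln$), comparison or draw from $[0,1)$ takes one step; scanning or copying a list or set costs its length; computing the least singular value and computing the inverse of an $m\times m$ matrix take $q(m)$ steps each, for an arbitrary fixed polynomial $q$. **Theorem.** For every polynomial $q$ with coefficients in $\mathbb N$ there is a real polynomial $P$ in four variables such that the following holds for all $n$, all $m\ge1$, all pairing structures $\mathcal T_1,\dots,\mathcal T_m$ with index set $[n]$ and $|S(\mathcal T_1)|\ge\dots\ge|S(\mathcal T_m)|$, and all $\delta,\varepsilon>0$. Let $\sigma_m$ be the least singular value of the correlation matrix of $X_{\mathcal T_1},\dots,X_{\mathcal T_m}$,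 and assume $\sigma_m>0$. 1. If $\varepsilon\le 2/5$, then with probability at least $1-\delta$ the algorithm ESTIMATOR halts and its output $f$ is $(\varepsilon,X)$-accurate for every $X\in\{1,X_{\mathcal T_1},\dots,X_{\mathcal T_m},f\}$. 2. The expected running time of ESTIMATOR is at most $P(1/\delta,\,1/\varepsilon,\,1/\sigma_m,\,R)$, where $R$ is the sum of the representation sizes of $\mathcal T_1,\dots,\mathcal T_m$. -/

import Mathlib

open MeasureTheory ProbabilityTheory

namespace HafnianMerge

/-! ### Pairings, hafnians and the Gaussian model -/

/-- `p` is a pairing of `K`: a set of two-element subsets of `K` such that every element of `K`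
lies in exactly one of them. -/
def IsPairing {n : ℕ} (K : Finset (Fin n)) (p : Finset (Sym2 (Fin n))) : Prop :=
  (∀ e ∈ p, ¬ e.IsDiag ∧ ∀ x ∈ e, x ∈ K) ∧ ∀ x ∈ K, ∃! e, e ∈ p ∧ x ∈ e

open Classical in
/-- The set of all pairings of `K`. -/
noncomputable def allPairings {n : ℕ} (K : Finset (Fin n)) : Finset (Finset (Sym2 (Fin n))) :=
  Finset.univ.filter (IsPairing K)

/-- `X_p(A) = ∏_{{i,j} ∈ p} A_{ij}`. Every matrix this is used with is symmetric, and the entry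
at the pair `{i, j}` is read off at row `min i j` and column `max i j`. -/
def pairingProduct {n : ℕ} (p : Finset (Sym2 (Fin n))) (A : Matrix (Fin n) (Fin n) ℝ) : ℝ :=
  ∏ e ∈ p, A e.inf e.sup

/-- `X_S(A) = ∑_{p ∈ S} X_p(A)`. -/
def pairingSum {n : ℕ} (S : Finset (Finset (Sym2 (Fin n)))) (A : Matrix (Fin n) (Fin n) ℝ) : ℝ :=
  ∑ p ∈ S, pairingProduct p A

/-- The hafnian: the sum of `X_p(A)` over all pairings `p` of the full index set. -/
noncomputable def hafnian {n : ℕ} (A : Matrix (Fin n) (Fin n) ℝ) : ℝ :=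
  pairingSum (allPairings Finset.univ) A

/-- The positions of the independent off-diagonal entries of a symmetric `n × n` matrix. -/
abbrev Edge (n : ℕ) : Type := {e : Sym2 (Fin n) // ¬ e.IsDiag}

/-- The off-diagonal part of the symmetric matrix with entries `w`. -/
def offDiag {n : ℕ} (w : Edge n → ℝ) : Matrix (Fin n) (Fin n) ℝ :=
  fun i j => if h : i = j then 0 else w ⟨s(i, j), by simpa using h⟩

/-- The random covariance matrix: its off-diagonal entries are `w`, and its diagonal entries are
large enough (diagonal dominance) to make it positive semidefinite. -/
def covMatrix {n : ℕ} (w : Edge n → ℝ) : Matrix (Fin n) (Fin n) ℝ :=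
  fun i j => if i = j then ∑ k, |offDiag w i k| else offDiag w i j

theorem offDiag_symm {n : ℕ} (w : Edge n → ℝ) (i j : Fin n) :
    offDiag w i j = offDiag w j i := by
  unfold offDiag
  by_cases h : i = j
  · simp [h]
  · have h' : ¬ j = i := fun e => h e.symm
    simp only [h, h', dite_false]
    congr 2
    exact Sym2.eq_swap

theorem covMatrix_posSemidef {n : ℕ} (w : Edge n → ℝ) : (covMatrix w).PosSemidef := by
  refine Matrix.PosSemidef.of_dotProduct_mulVec_nonneg ?_ ?_
  · ext i j
    by_cases h : i = j
    · simp [covMatrix, h]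
    · have h' : ¬ j = i := fun e => h e.symm
      simp [covMatrix, h, h', offDiag_symm w i j]
  · intro x
    have h0 : ∀ i, offDiag w i i = 0 := fun i => by simp [offDiag]
    have key : ∀ i, ∑ j, covMatrix w i j * x j
        = ∑ k, (|offDiag w i k| * x i + offDiag w i k * x k) := by
      intro i
      rw [Finset.sum_add_distrib, ← Finset.sum_mul]
      have : ∀ j, covMatrix w i j * x j
          = (if i = j then (∑ k, |offDiag w i k|) * x j else 0) + offDiag w i j * x j := by
        intro j
        by_cases h : i = j
        · subst h; simp [covMatrix, h0]
        · simp [covMatrix, h]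
      simp only [this, Finset.sum_add_distrib, Finset.sum_ite_eq, Finset.mem_univ, if_true]
    have e1 : star x ⬝ᵥ (covMatrix w).mulVec x
        = ∑ i, ∑ k, (|offDiag w i k| * x i ^ 2 + offDiag w i k * (x i * x k)) := by
      simp only [dotProduct, Matrix.mulVec, key, Pi.star_apply, star_trivial, Finset.mul_sum]
      refine Finset.sum_congr rfl fun i _ => Finset.sum_congr rfl fun k _ => ?_
      ring
    have e2 : star x ⬝ᵥ (covMatrix w).mulVec x
        = ∑ i, ∑ k, (|offDiag w i k| * x k ^ 2 + offDiag w i k * (x i * x k)) := by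
      rw [e1, Finset.sum_comm]
      refine Finset.sum_congr rfl fun i _ => Finset.sum_congr rfl fun k _ => ?_
      rw [offDiag_symm w k i]; ring
    have e3 : 0 ≤ star x ⬝ᵥ (covMatrix w).mulVec x + star x ⬝ᵥ (covMatrix w).mulVec x := by
      nth_rewrite 1 [e1]
      rw [e2, ← Finset.sum_add_distrib]
      refine Finset.sum_nonneg fun i _ => ?_
      rw [← Finset.sum_add_distrib]
      refine Finset.sum_nonneg fun k _ => ?_
      have ha := neg_abs_le (offDiag w i k)
      have hb := le_abs_self (offDiag w i k)
      nlinarith [mul_nonneg (sub_nonneg.2 hb) (sq_nonneg (x i - x k)),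
        mul_nonneg (by linarith : 0 ≤ |offDiag w i k| + offDiag w i k) (sq_nonneg (x i + x k))]
    linarith

/-- The law of the off-diagonal entries: independent standard normal variables. -/
noncomputable def gaussianWeights (n : ℕ) : Measure (Edge n → ℝ) :=
  Measure.pi fun _ => gaussianReal 0 1

/-! ### Pairing structures -/

/-- Expressions built from base pairs by unions and products. -/
inductive PairingTree (n : ℕ) : Type
  | base (i j : Fin n) : PairingTree n
  | union (T U : PairingTree n) : PairingTree n
  | prod (T U : PairingTree n) : PairingTree n

namespace PairingTree

variable {n : ℕ}

/-- The index set of a pairing structure. -/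
def index : PairingTree n → Finset (Fin n)
  | base i j => {i, j}
  | union T _ => T.index
  | prod T U => T.index ∪ U.index

/-- The set `S(T)` of pairings that `T` represents. -/
def pairings : PairingTree n → Finset (Finset (Sym2 (Fin n)))
  | base i j => {{s(i, j)}}
  | union T U => T.pairings ∪ U.pairings
  | prod T U => Finset.image₂ (· ∪ ·) T.pairings U.pairings

/-- The side conditions on pairing structures: the two points of a base structure are distinct,
the two sides of a union have the same index set and represent disjoint sets of pairings, and the
two sides of a product have disjoint index sets. -/
def WellFormed : PairingTree n → Prop
  | base i j => i ≠ j
  | union T U => T.WellFormed ∧ U.WellFormed ∧ T.index = U.index ∧ Disjoint T.pairings U.pairings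
  | prod T U => T.WellFormed ∧ U.WellFormed ∧ Disjoint T.index U.index

/-- The representation size. -/
def rsize : PairingTree n → ℕ
  | base _ _ => 1
  | union T U => T.rsize + U.rsize + 1
  | prod T U => T.rsize + U.rsize + 1

end PairingTree

/-- A pairing structure with index set `[n]`. -/
structure PairingStructure (n : ℕ) where
  tree : PairingTree n
  wellFormed : tree.WellFormed
  index_eq : tree.index = Finset.univ

/-- The predictor `X_T`, as a random variable on the Gaussian model. -/
def PairingStructure.predictor {n : ℕ} (T : PairingStructure n) (w : Edge n → ℝ) : ℝ :=
  pairingSum T.tree.pairings (covMatrix w)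

/-- The quantity `Y` to be estimated. -/
noncomputable def target {n : ℕ} (w : Edge n → ℝ) : ℝ := hafnian (covMatrix w)

/-! ### Approximate accuracy, correlation matrix, least singular value -/

/-- `f` is an `(ε, X)`-accurate estimator of `Y`:
`E[(Y - f) X]² ≤ ε² E[X²] E[f²]`, all three variables being square integrable. -/
def IsApproxAccurate {Ω : Type*} [MeasurableSpace Ω] (μ : Measure Ω) (Y : Ω → ℝ) (ε : ℝ)
    (X f : Ω → ℝ) : Prop :=
  MemLp Y 2 μ ∧ MemLp X 2 μ ∧ MemLp f 2 μ ∧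
    (∫ w, (Y w - f w) * X w ∂μ) ^ 2 ≤ ε ^ 2 * (∫ w, X w ^ 2 ∂μ) * ∫ w, f w ^ 2 ∂μ

/-- A randomized algorithm with randomness `(R, ρ)` and output `out` (`none` if it does not halt) is
`(δ, ε, S)`-multiaccurate: with probability at least `1 - δ` it halts with an output `f` that is
`(ε, X)`-accurate for all `X ∈ S`. The set `S` may depend on the output. -/
def IsAlgMultiaccurate {Ω R : Type*} [MeasurableSpace Ω] [MeasurableSpace R]
    (μ : Measure Ω) (Y : Ω → ℝ) (ρ : Measure R) (out : R → Option (Ω → ℝ)) (δ ε : ℝ)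
    (S : (Ω → ℝ) → Set (Ω → ℝ)) : Prop :=
  ENNReal.ofReal (1 - δ) ≤
    ρ {r | ∃ f, out r = some f ∧ ∀ X ∈ S f, IsApproxAccurate μ Y ε X f}

/-- The correlation matrix of finitely many random variables. -/
noncomputable def corrMatrix {Ω : Type*} [MeasurableSpace Ω] (μ : Measure Ω) {m : ℕ}
    (X : Fin m → Ω → ℝ) : Matrix (Fin m) (Fin m) ℝ :=
  fun i j => cov[X i, X j; μ] / √(Var[X i; μ] * Var[X j; μ])

/-- The least singular value of an `m × m` matrix, `m ≥ 1`. Singular values are listed in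
decreasing order starting from index `0`. -/
noncomputable def leastSingularValue {m : ℕ} (A : Matrix (Fin m) (Fin m) ℝ) : ℝ :=
  (Matrix.toEuclideanLin A).singularValues (m - 1)

/-! ### Step-counted computations -/

/-- The result of a computation together with the number of steps it took. -/
structure Timed (α : Type) : Type where
  val : α
  steps : ℕ

instance : Monad Timed where
  pure a := ⟨a, 0⟩
  bind x f := ⟨(f x.val).val, x.steps + (f x.val).steps⟩

instance (α : Type) : MeasurableSpace (Timed α) := ⊤

/-- Spend `k` steps. -/
def Timed.tick (k : ℕ) : Timed Unit := ⟨(), k⟩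

/-- A randomized step-counted computation, given by the joint law of its result and step count. -/
structure Rand (α : Type) : Type where
  law : PMF (Timed α)

noncomputable instance : Monad Rand where
  pure a := ⟨PMF.pure ⟨a, 0⟩⟩
  bind x f := ⟨x.law.bind fun a => (f a.val).law.map fun b => ⟨b.val, a.steps + b.steps⟩⟩

/-- A deterministic computation as a randomized one. -/
noncomputable def Timed.toRand {α : Type} (x : Timed α) : Rand α := ⟨PMF.pure x⟩

/-- The uniform distribution on `[0, 1)`. -/
noncomputable def uniform01 : Measure ℝ := volume.restrict (Set.Ico 0 1)

instance : IsProbabilityMeasure uniform01 := ⟨by simp [uniform01]⟩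

open Classical in
theorem measurable_decide_lt (q : ℝ) : Measurable fun r : ℝ => decide (r < q) := by
  refine measurable_to_bool ?_
  have : (fun r : ℝ => decide (r < q)) ⁻¹' {true} = Set.Iio q := by ext; simp
  rw [this]
  exact measurableSet_Iio

open Classical in
instance (q : ℝ) : IsProbabilityMeasure (uniform01.map fun r => decide (r < q)) :=
  Measure.isProbabilityMeasure_map (measurable_decide_lt q).aemeasurable

open Classical in
/-- Draw `r` uniformly from `[0, 1)` and report whether `r < q`: two steps. -/
noncomputable def uniformLt (q : ℝ) : Rand Bool :=
  ⟨(uniform01.map fun r => decide (r < q)).toPMF.map fun b => ⟨b, 2⟩⟩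

/-! ### The algorithm

Arithmetic operations (including `√` and `log`), comparisons and draws from `[0, 1)` take one step
each, on real numbers; scanning or copying a list or a set costs its length. -/

/-- A pairing, as the list of its pairs. -/
abbrev PairList (n : ℕ) : Type := List (Fin n × Fin n)

section Algorithm

variable {n : ℕ}

/-- Returns `|S(T)|`. -/
def numPairings : PairingTree n → Timed ℕ
  | .base _ _ => do
      Timed.tick 1
      return 1
  | .prod T U => do
      let a ← numPairings T
      let b ← numPairings U
      Timed.tick 2
      return a * b
  | .union T U => do
      let a ← numPairings T
      let b ← numPairings U
      Timed.tick 2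
      return a + b

/-- Returns a random element of `S(T)`. -/
noncomputable def sample : PairingTree n → Rand (PairList n)
  | .base i j => do
      (Timed.tick 1).toRand
      return [(i, j)]
  | .prod T U => do
      let p ← sample T
      let q ← sample U
      (Timed.tick (p.length + 2)).toRand
      return p ++ q
  | .union T U => do
      let a ← (numPairings T).toRand
      let b ← (numPairings (.union T U)).toRand
      (Timed.tick 2).toRand
      let c ← uniformLt ((a : ℝ) / b)
      if c then sample T else sample U

/-- Membership test in a set of indices, by scanning it. -/
def memTest (K : Finset (Fin n)) (i : Fin n) : Timed Bool := ⟨decide (i ∈ K), K.card + 1⟩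

/-- Returns the restriction of the pairing `p` to `K`, or `none` if some pair of `p` has exactly one
element in `K`. -/
def split (K : Finset (Fin n)) : PairList n → Timed (Option (PairList n))
  | [] => do
      Timed.tick 1
      return some []
  | (i, j) :: p => do
      let a ← memTest K i
      let b ← memTest K j
      Timed.tick 2
      if a != b then
        return none
      else
        let r ← split K p
        return (if a then r.map fun p' => (i, j) :: p' else r)

/-- The pairs in `p` that are not in `q`, by scanning `q` for each member of `p`. -/
def listDiff (p q : PairList n) : Timed (PairList n) :=
  ⟨p.filter fun e => e ∉ q, p.length * (2 * q.length + 2) + 1⟩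

/-- Decides whether `p`, a pairing of the index set of `T`, belongs to `S(T)`. The index sets of the
substructures are taken to be stored with them. -/
def contains : PairingTree n → PairList n → Timed Bool
  | .base _ _, _ => do
      Timed.tick 1
      return true
  | .prod T U, p => do
      Timed.tick 1
      let r ← split T.index p
      match r with
      | none => return false
      | some p₁ =>
          let a ← contains T p₁
          if a then
            let p₂ ← listDiff p p₁
            contains U p₂
          else
            return false
  | .union T U, p => do
      Timed.tick 1
      let a ← contains T p
      if a then return true else contains U p

variable {m : ℕ}

/-- The randomness of the estimator: at `(s, i, j)`, the result and step count of the call of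
`sample` on the `j`-th structure during loop iteration `s` that is tested against the `i`-th
structure (only used for `i < j`). -/
abbrev Draws (n m : ℕ) : Type := ℕ × Fin m × Fin m → Timed (PairList n)

/-- All calls of `sample` are independent. -/
noncomputable def drawsLaw (T : Fin m → PairingStructure n) : Measure (Draws n m) :=
  Measure.infinitePi fun k => (sample (T k.2.2).tree).law.toMeasure

/-- The diagonal of `D`: square roots of the numbers of pairings. -/
noncomputable def diagD (T : Fin m → PairingStructure n) (i : Fin m) : ℝ :=
  √((numPairings (T i).tree).val)

/-- The membership test for the pair `i < j` in iteration `s`. -/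
def hit (T : Fin m → PairingStructure n) (ω : Draws n m) (s : ℕ) (i j : Fin m) : Timed Bool :=
  contains (T i).tree (ω (s, i, j)).val

/-- The matrix `M` after `s` iterations of the loop, and the number of steps used so far. Each
iteration increments `s`; for every `i` increments `M i i`; for all `i < j` calls `sample` and
`contains` and increments `M i j` and `M j i` if the test succeeds; computes the estimated
correlation matrix; computes its least singular value, which is charged `q m` steps; and
evaluates the loop condition. -/
noncomputable def loopState (q : Polynomial ℕ) (T : Fin m → PairingStructure n) (ω : Draws n m) :
    ℕ → Timed (Matrix (Fin m) (Fin m) ℕ)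
  | 0 => ⟨0, (∑ i, ((numPairings (T i).tree).steps + 2)) + m ^ 2 + 1⟩
  | s + 1 =>
      ⟨fun i j =>
          if i = j ∨ (hit T ω (s + 1) (min i j) (max i j)).val = true
          then (loopState q T ω s).val i j + 1 else (loopState q T ω s).val i j,
        (loopState q T ω s).steps + 1
          + (∑ i, (1 + ∑ j ∈ Finset.Ioi i,
              ((ω (s + 1, i, j)).steps + (hit T ω (s + 1) i j).steps + 3)))
          + 4 * m ^ 2 + q.eval m + 20⟩

/-- The estimated correlation matrix after `s` iterations: the symmetric matrix whose entries on and
above the diagonal are those of `D⁻¹ M D / s`. -/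
noncomputable def estCorr (q : Polynomial ℕ) (T : Fin m → PairingStructure n) (ω : Draws n m)
    (s : ℕ) : Matrix (Fin m) (Fin m) ℝ :=
  fun i j => (diagD T (min i j))⁻¹ * ((loopState q T ω s).val i j : ℝ) * diagD T (max i j) / s

/-- The loop is left after iteration `s`. -/
def Stops (q : Polynomial ℕ) (T : Fin m → PairingStructure n) (δ ε : ℝ) (ω : Draws n m)
    (s : ℕ) : Prop :=
  1 ≤ s ∧ 0 < leastSingularValue (estCorr q T ω s) ∧
    80 * (m : ℝ) ^ 2 * ((m : ℝ) ^ 2 + 3 * Real.log (2 / δ))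
      / (ε ^ 2 * leastSingularValue (estCorr q T ω s) ^ 4) ≤ s

open Classical in
/-- The number of iterations, `none` if the loop is never left. -/
noncomputable def numSamples (q : Polynomial ℕ) (T : Fin m → PairingStructure n) (δ ε : ℝ)
    (ω : Draws n m) : Option ℕ :=
  if h : ∃ s, Stops q T δ ε ω s then some (Nat.find h) else none

/-- The regression coefficients `β = D⁻¹ Ĉ⁻¹ diag(D)` after `s` iterations. -/
noncomputable def coeffs (q : Polynomial ℕ) (T : Fin m → PairingStructure n) (ω : Draws n m)
    (s : ℕ) : Fin m → ℝ :=
  fun i => (diagD T i)⁻¹ * ((estCorr q T ω s)⁻¹.mulVec (diagD T)) i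

/-- The output of the algorithm: the function `x ↦ βᵀ x`. -/
noncomputable def estimator (q : Polynomial ℕ) (T : Fin m → PairingStructure n) (δ ε : ℝ)
    (ω : Draws n m) : Option ((Fin m → ℝ) → ℝ) :=
  (numSamples q T δ ε ω).map fun s x => coeffs q T ω s ⬝ᵥ x

/-- The running time: infinite if the loop is never left, and otherwise the steps of the loop, plus
`q m` steps for inverting the estimated correlation matrix, plus those for computing and
returning the coefficients. -/
noncomputable def runtime (q : Polynomial ℕ) (T : Fin m → PairingStructure n) (δ ε : ℝ)
    (ω : Draws n m) : ENNReal :=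
  match numSamples q T δ ε ω with
  | none => ⊤
  | some s => (((loopState q T ω s).steps + q.eval m + 2 * m ^ 2 + 3 * m + 1 : ℕ) : ENNReal)

/-- The output of the algorithm as an estimator on the Gaussian model: the returned function applied
to `X_{T_1}, …, X_{T_m}`. -/
noncomputable def estimatorOutput (q : Polynomial ℕ) (T : Fin m → PairingStructure n) (δ ε : ℝ)
    (ω : Draws n m) : Option ((Edge n → ℝ) → ℝ) :=
  (estimator q T δ ε ω).map fun g w => g fun i => (T i).predictor w

end Algorithm

end HafnianMerge

/-! Under the Gaussian model the monomials of the pairings of `[n]` are orthonormal, so second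
moments are counts: E[X_i X_j] = |S_i ∩ S_j| and E[Y X_i] = |S_i| = d_i². With C the correlation
matrix and v = Dβ, exact regression of Y on the X_i means C v = d, while the algorithm solves Ĉ v =
d. The residual u = (Ĉ − C)v = d − C v then governs all errors: E[(Y − f) X_i] = d_i u_i, E[(Y − f)
f] = v·u, and E[f²] = vᵀCv ≥ σ_m |v|². Hence a Frobenius error of Ĉ of at most ε σ_m suffices
(`isApproxAccurate_of_sum_sq_le`).

Sampling is uniform and the membership test is exact, so each off-diagonal M_ij (i < j) is a sum of
independent Bernoulli variables of mean |S_i ∩ S_j| / |S_j|. The ordering of the structures makes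
the rescaling d_j / d_i at most 1, so the squared Frobenius error after s rounds is at most 2/s²
times ‖S_s‖², where S_s is a sum of s independent, centered, bounded vectors with m² coordinates
(`sum_sq_estCorr_sub_le`).

The stopping time depends on the same draws, so accuracy needs a bound valid at all times at once.
The process exp(‖S_s‖²/N) is a submartingale whose mean at time N is at most √2 to the power m², by
Gaussian linearization. Doob's inequality controls all s ≤ N, and peeling time into blocks of ratio
4 gives a bound of order s^(3/2) on ‖S_s‖² (`measure_exists_sq_sqNormSum_ge_le`). Inserting the
stopping rule yields an error of at most (5/7) ε σ̂_m, and Weyl's perturbation inequality replaces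
σ̂_m by σ_m.

For the running time, once s exceeds a polynomial threshold s₁, not stopping forces ‖S_s‖² ≥ σ_m²
s²/8, an event of probability at most exp(−σ_m² (s − s₁)/8). Summing gives at most s₁ + 1 + 8/σ_m²
expected rounds, each of which almost surely costs a polynomial in the representation size. -/

namespace HafnianMerge

/-! ### A maximal inequality for sums of independent subgaussian vectors -/

section Maximal

set_option linter.unusedSectionVars false

variable {ι : Type*} [Fintype ι]

/-- The `i`-th coordinate of the sum of the first `k` terms of a sequence of vectors. -/
def partialSum (x : ℕ × ι → ℝ) (k : ℕ) (i : ι) : ℝ := ∑ r ∈ Finset.range k, x (r, i)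

/-- The squared Euclidean norm of the sum of the first `k` terms of a sequence of vectors. -/
def sqNormSum (x : ℕ × ι → ℝ) (k : ℕ) : ℝ := ∑ i, partialSum x k i ^ 2

theorem measurable_partialSum (k : ℕ) (i : ι) :
    Measurable fun x : ℕ × ι → ℝ => partialSum x k i := by
  unfold partialSum; fun_prop

theorem measurable_sqNormSum (k : ℕ) : Measurable fun x : ℕ × ι → ℝ => sqNormSum x k := by
  unfold sqNormSum partialSum; fun_prop

theorem partialSum_congr {x y : ℕ × ι → ℝ} {k : ℕ} (h : ∀ p : ℕ × ι, p.1 < k → x p = y p)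
    {s : ℕ} (hs : s ≤ k) : partialSum x s = partialSum y s := by
  funext i
  exact Finset.sum_congr rfl fun r hr => h _ (lt_of_lt_of_le (Finset.mem_range.1 hr) hs)

theorem sqNormSum_congr {x y : ℕ × ι → ℝ} {k : ℕ} (h : ∀ p : ℕ × ι, p.1 < k → x p = y p)
    {s : ℕ} (hs : s ≤ k) : sqNormSum x s = sqNormSum y s := by
  simp only [sqNormSum, partialSum_congr h hs]

theorem abs_partialSum_le {x : ℕ × ι → ℝ} (hx : ∀ p, |x p| ≤ 1) (k : ℕ) (i : ι) :
    |partialSum x k i| ≤ k := by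
  refine (Finset.abs_sum_le_sum_abs _ _).trans ?_
  refine (Finset.sum_le_sum fun r _ => hx (r, i)).trans ?_
  simp

theorem sqNormSum_nonneg (x : ℕ × ι → ℝ) (k : ℕ) : 0 ≤ sqNormSum x k :=
  Finset.sum_nonneg fun _ _ => sq_nonneg _

theorem sqNormSum_le {x : ℕ × ι → ℝ} (hx : ∀ p, |x p| ≤ 1) (k : ℕ) :
    sqNormSum x k ≤ Fintype.card ι * (k : ℝ) ^ 2 := by
  refine (Finset.sum_le_sum fun i _ => sq_le_sq' ?_ (le_of_abs_le (abs_partialSum_le hx k i))).trans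
    (by simp)
  exact neg_le_of_abs_le (abs_partialSum_le hx k i)

/-- The sequences whose partial sums have squared norm at least `a` at some time up to `k`. -/
def exceedSet (a : ℝ) (k : ℕ) : Set (ℕ × ι → ℝ) := {x | ∃ s ≤ k, a ≤ sqNormSum x s}

theorem measurableSet_exceedSet (a : ℝ) (k : ℕ) :
    MeasurableSet (exceedSet a k : Set (ℕ × ι → ℝ)) := by
  have : (exceedSet a k : Set (ℕ × ι → ℝ))
      = ⋃ s ∈ Finset.range (k + 1), {x | a ≤ sqNormSum x s} := by
    ext x; simp [exceedSet]
  rw [this]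
  exact Finset.measurableSet_biUnion _ fun s _ => measurableSet_le measurable_const
    (measurable_sqNormSum s)

theorem exceedSet_succ (a : ℝ) (k : ℕ) :
    (exceedSet a (k + 1) : Set (ℕ × ι → ℝ)) = exceedSet a k ∪ {x | a ≤ sqNormSum x (k + 1)} := by
  ext x
  simp only [exceedSet, Set.mem_ofPred_eq, Set.mem_union]
  constructor
  · rintro ⟨s, hs, h⟩
    rcases Nat.lt_or_ge k s with hk | hk
    · right; rwa [show k + 1 = s by omega]
    · exact Or.inl ⟨s, hk, h⟩
  · rintro (⟨s, hs, h⟩ | h)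
    · exact ⟨s, by omega, h⟩
    · exact ⟨k + 1, le_rfl, h⟩

variable {Ω : Type*} [MeasurableSpace Ω] {μ : Measure Ω} [IsProbabilityMeasure μ]
  {ξ : ℕ × ι → Ω → ℝ}

/-- Martingale-difference property: a function of the terms before time `k` is independent of a term
at time `k`, so the expectation factors. -/
theorem integral_past_mul_eq_zero (hξ : iIndepFun ξ μ) (hm : ∀ p, Measurable (ξ p))
    {G : (ℕ × ι → ℝ) → ℝ} (hG : Measurable G) {k : ℕ}
    (hdep : ∀ x y : ℕ × ι → ℝ, (∀ p : ℕ × ι, p.1 < k → x p = y p) → G x = G y) (i : ι)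
    (h0 : ∫ ω, ξ (k, i) ω ∂μ = 0) :
    ∫ ω, G (fun p => ξ p ω) * ξ (k, i) ω ∂μ = 0 := by
  classical
  set S : Finset (ℕ × ι) := Finset.range k ×ˢ Finset.univ with hS
  have hd : Disjoint S {(k, i)} := by simp [hS]
  have hind := hξ.indepFun_finset S {(k, i)} hd hm
  -- `G` as a function of finitely many coordinates; by `hdep` the filler value 0 outside `S` is
  -- immaterial.
  let G' : (S → ℝ) → ℝ := fun y => G fun p => if h : p ∈ S then y ⟨p, h⟩ else 0
  have hG' : Measurable G' := by
    refine hG.comp (measurable_pi_lambda _ fun p => ?_)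
    by_cases h : p ∈ S
    · simp only [h, dite_true]; fun_prop
    · simp only [h, dite_false]; fun_prop
  have hind2 := hind.comp hG' (measurable_pi_apply (⟨(k, i), by simp⟩ : ({(k, i)} : Finset _)))
  have e : (G' ∘ fun a (i : S) => ξ i a) = fun ω => G (fun p => ξ p ω) := by
    funext ω
    refine hdep _ _ fun p hp => ?_
    have : p ∈ S := by simp [hS, hp]
    simp [this]
  rw [e] at hind2
  have := hind2.integral_fun_mul_eq_mul_integral
    (hG.comp (measurable_pi_lambda _ hm)).aestronglyMeasurable
    (hm (k, i)).aestronglyMeasurable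
  simp only [Function.comp_def] at this
  rw [this, h0, mul_zero]

/-- Drop the square of the increment and use e^t ≥ 1 + t. The lower bound is affine in the new
terms, with coefficients determined by the past, so centered increments make exp(l‖S_k‖²) a
submartingale. -/
theorem exp_sqNormSum_succ_ge (x : ℕ × ι → ℝ) (k : ℕ) {l : ℝ} (hl : 0 ≤ l) :
    Real.exp (l * sqNormSum x k)
        + ∑ i, 2 * l * (Real.exp (l * sqNormSum x k) * partialSum x k i) * x (k, i)
      ≤ Real.exp (l * sqNormSum x (k + 1)) := by
  have h1 : sqNormSum x k + 2 * ∑ i, partialSum x k i * x (k, i) ≤ sqNormSum x (k + 1) := by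
    simp only [sqNormSum, Finset.mul_sum, ← Finset.sum_add_distrib]
    refine Finset.sum_le_sum fun i _ => ?_
    have : partialSum x (k + 1) i = partialSum x k i + x (k, i) := Finset.sum_range_succ _ _
    rw [this]
    nlinarith [sq_nonneg (x (k, i))]
  have h2 : Real.exp (l * sqNormSum x k) * (1 + l * (2 * ∑ i, partialSum x k i * x (k, i)))
      ≤ Real.exp (l * sqNormSum x (k + 1)) := by
    calc _ ≤ Real.exp (l * sqNormSum x k)
            * Real.exp (l * (2 * ∑ i, partialSum x k i * x (k, i))) := by
          gcongr
          linarith [Real.add_one_le_exp (l * (2 * ∑ i, partialSum x k i * x (k, i)))]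
      _ = Real.exp (l * (sqNormSum x k + 2 * ∑ i, partialSum x k i * x (k, i))) := by
          rw [← Real.exp_add, mul_add]
      _ ≤ _ := by gcongr
  refine le_trans (le_of_eq ?_) h2
  rw [mul_add, mul_one, Finset.mul_sum, Finset.mul_sum, Finset.mul_sum]
  congr 1
  exact Finset.sum_congr rfl fun i _ => by ring

theorem integrable_exceed_indicator (hm : ∀ p, Measurable (ξ p)) (hb : ∀ p ω, |ξ p ω| ≤ 1)
    {A : Set (ℕ × ι → ℝ)} (hA : MeasurableSet A) {l : ℝ} (hl : 0 ≤ l) (k : ℕ) :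
    Integrable (fun ω => A.indicator (fun x => Real.exp (l * sqNormSum x k)) fun p => ξ p ω) μ := by
  have hmeas : Measurable fun ω p => ξ p ω := measurable_pi_lambda _ hm
  refine Integrable.of_bound (C := Real.exp (l * (Fintype.card ι * (k : ℝ) ^ 2)))
    ((((measurable_sqNormSum k).const_mul l).exp.indicator hA).comp hmeas).aestronglyMeasurable
    (ae_of_all _ fun ω => ?_)
  refine (norm_indicator_le_norm_self _ _).trans ?_
  rw [Real.norm_of_nonneg (Real.exp_pos _).le]
  have := sqNormSum_le (fun p => hb p ω) k
  gcongr

/-- The submartingale property on an event determined by the first `k` terms: its indicator is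
absorbed into the coefficients of the linear terms, which therefore still integrate to zero. -/
theorem integral_indicator_exp_le_succ (hξ : iIndepFun ξ μ) (hm : ∀ p, Measurable (ξ p))
    (hb : ∀ p ω, |ξ p ω| ≤ 1) (h0 : ∀ p, ∫ ω, ξ p ω ∂μ = 0) (a : ℝ) {l : ℝ} (hl : 0 ≤ l) (k : ℕ) :
    ∫ ω, (exceedSet a k).indicator (fun x => Real.exp (l * sqNormSum x k)) (fun p => ξ p ω) ∂μ
      ≤ ∫ ω, (exceedSet a k).indicator (fun x => Real.exp (l * sqNormSum x (k + 1)))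
          (fun p => ξ p ω) ∂μ := by
  have hmeas : Measurable fun ω p => ξ p ω := measurable_pi_lambda _ hm
  have hA := measurableSet_exceedSet (ι := ι) a k
  let G : ι → (ℕ × ι → ℝ) → ℝ := fun i => (exceedSet a k).indicator
    fun x => 2 * l * (Real.exp (l * sqNormSum x k) * partialSum x k i)
  have hG : ∀ i, Measurable (G i) := fun i =>
    ((((measurable_sqNormSum k).const_mul l).exp.mul (measurable_partialSum k i)).const_mul
      (2 * l)).indicator hA
  have hz : ∀ i, ∫ ω, G i (fun p => ξ p ω) * ξ (k, i) ω ∂μ = 0 := fun i => by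
    refine integral_past_mul_eq_zero hξ hm (hG i) (fun x y hxy => ?_) i (h0 _)
    have e : x ∈ exceedSet a k ↔ y ∈ exceedSet a k :=
      exists_congr fun s => and_congr_right fun hs => by rw [sqNormSum_congr hxy hs]
    by_cases h : x ∈ exceedSet a k
    · simp only [G, Set.indicator_of_mem h, Set.indicator_of_mem (e.1 h),
        sqNormSum_congr hxy le_rfl, partialSum_congr hxy le_rfl]
    · simp only [G, Set.indicator_of_notMem h, Set.indicator_of_notMem fun h' => h (e.2 h')]
  have hGi : ∀ i, Integrable (fun ω => G i (fun p => ξ p ω) * ξ (k, i) ω) μ := fun i => by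
    refine Integrable.of_bound
      (C := 2 * l * (Real.exp (l * (Fintype.card ι * (k : ℝ) ^ 2)) * k))
      ((((hG i).comp hmeas).mul (hm (k, i))).aestronglyMeasurable) (ae_of_all _ fun ω => ?_)
    rw [norm_mul]
    refine (mul_le_of_le_one_right (norm_nonneg _) (hb _ ω)).trans ?_
    refine (norm_indicator_le_norm_self _ _).trans ?_
    rw [norm_mul, Real.norm_of_nonneg (by positivity : 0 ≤ 2 * l), norm_mul,
      Real.norm_of_nonneg (Real.exp_pos _).le]
    have h1 := sqNormSum_le (fun p => hb p ω) k
    have h2 := abs_partialSum_le (fun p => hb p ω) k i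
    rw [Real.norm_eq_abs]
    gcongr
  have hsum : Integrable (fun ω => ∑ i, G i (fun p => ξ p ω) * ξ (k, i) ω) μ :=
    integrable_finsetSum _ fun i _ => hGi i
  have hint := integrable_exceed_indicator (μ := μ) hm hb hA hl k
  have hle : ∫ ω, ((exceedSet a k).indicator (fun x => Real.exp (l * sqNormSum x k))
        (fun p => ξ p ω) + ∑ i, G i (fun p => ξ p ω) * ξ (k, i) ω) ∂μ
      ≤ ∫ ω, (exceedSet a k).indicator (fun x => Real.exp (l * sqNormSum x (k + 1)))
          (fun p => ξ p ω) ∂μ := by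
    refine integral_mono (hint.add hsum) (integrable_exceed_indicator hm hb hA hl (k + 1))
      fun ω => ?_
    by_cases h : (fun p => ξ p ω) ∈ exceedSet a k
    · simp only [G, Set.indicator_of_mem h]
      exact exp_sqNormSum_succ_ge (fun p => ξ p ω) k hl
    · simp [G, Set.indicator_of_notMem h]
  rw [integral_add hint hsum, integral_finsetSum _ fun i _ => hGi i] at hle
  simpa [hz] using hle

/-- Doob's maximal inequality for exp(l‖S_k‖²), by induction on `k`: on paths that exceeded earlier
the submartingale property carries the bound forward, and on the others Markov's inequality applies.
-/
theorem measure_exceed_mul_exp_le (hξ : iIndepFun ξ μ) (hm : ∀ p, Measurable (ξ p))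
    (hb : ∀ p ω, |ξ p ω| ≤ 1) (h0 : ∀ p, ∫ ω, ξ p ω ∂μ = 0) {a l : ℝ} (hl : 0 ≤ l) (k : ℕ) :
    Real.exp (l * a) * μ.real ((fun ω p => ξ p ω) ⁻¹' exceedSet a k)
      ≤ ∫ ω, (exceedSet a k).indicator (fun x => Real.exp (l * sqNormSum x k))
          (fun p => ξ p ω) ∂μ := by
  have hmeas : Measurable fun ω p => ξ p ω := measurable_pi_lambda _ hm
  -- Markov's inequality on an event where the norm at the current time is already large.
  have key : ∀ (A : Set (ℕ × ι → ℝ)), MeasurableSet A → ∀ k, (∀ x ∈ A, a ≤ sqNormSum x k) →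
      Real.exp (l * a) * μ.real ((fun ω p => ξ p ω) ⁻¹' A)
      ≤ ∫ ω, A.indicator (fun x => Real.exp (l * sqNormSum x k)) (fun p => ξ p ω) ∂μ := by
    intro A hA k hk
    have : Real.exp (l * a) * μ.real ((fun ω p => ξ p ω) ⁻¹' A)
        = ∫ ω, A.indicator (fun _ => Real.exp (l * a)) (fun p => ξ p ω) ∂μ := by
      have e : (fun ω => A.indicator (fun _ => Real.exp (l * a)) (fun p => ξ p ω))
          = ((fun ω p => ξ p ω) ⁻¹' A).indicator fun _ => Real.exp (l * a) := by
        funext ω; exact Set.indicator_comp_right (g := fun _ => Real.exp (l * a)) _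
      rw [e, integral_indicator_const _ (hmeas hA), smul_eq_mul, mul_comm]
    rw [this]
    refine integral_mono ?_ (integrable_exceed_indicator hm hb hA hl k) fun ω => ?_
    · exact Integrable.of_bound (C := Real.exp (l * a))
        ((measurable_const.indicator hA).comp hmeas).aestronglyMeasurable
        (ae_of_all _ fun ω => (norm_indicator_le_norm_self _ _).trans (by simp))
    · refine Set.indicator_le_indicator' fun h => ?_
      have := hk _ h
      gcongr
  induction k with
  | zero =>
    refine key _ (measurableSet_exceedSet a 0) 0 fun x hx => ?_
    obtain ⟨s, hs, h⟩ := hx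
    rwa [Nat.le_zero.1 hs] at h
  | succ k ih =>
    -- The paths whose first exceedance happens exactly at time `k + 1`.
    set N : Set (ℕ × ι → ℝ) := {x | a ≤ sqNormSum x (k + 1)} \ exceedSet a k with hN
    have hNm : MeasurableSet N :=
      (measurableSet_le measurable_const (measurable_sqNormSum (k + 1))).diff
        (measurableSet_exceedSet a k)
    have hdis : Disjoint (exceedSet a k) N := Set.disjoint_sdiff_right
    have hU : (exceedSet a (k + 1) : Set (ℕ × ι → ℝ)) = exceedSet a k ∪ N := by
      rw [exceedSet_succ, hN, Set.union_sdiff_self]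
    have e1 : μ.real ((fun ω p => ξ p ω) ⁻¹' exceedSet a (k + 1))
        = μ.real ((fun ω p => ξ p ω) ⁻¹' exceedSet a k)
          + μ.real ((fun ω p => ξ p ω) ⁻¹' N) := by
      rw [hU, Set.preimage_union, measureReal_union (hdis.preimage _) (hmeas hNm)]
    have e2 := integral_add
      (integrable_exceed_indicator (μ := μ) hm hb (measurableSet_exceedSet a k) hl (k + 1))
      (integrable_exceed_indicator (μ := μ) hm hb hNm hl (k + 1))
    rw [e1, mul_add, hU, Set.indicator_union_of_disjoint hdis, e2]
    exact add_le_add (ih.trans (integral_indicator_exp_le_succ hξ hm hb h0 a hl k))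
      (key N hNm (k + 1) fun x hx => hx.1)

end Maximal

/-! ### Exponential moments of squared norms of subgaussian vectors -/

/-- The Gaussian moment generating function read backwards: the exponential of a square becomes an
average of exponentials of linear forms. -/
theorem exp_sq_eq_integral_gaussian (v : NNReal) (w : ℝ) :
    ∫ g, Real.exp (g * w) ∂gaussianReal 0 v = Real.exp (v * w ^ 2 / 2) := by
  have := mgf_gaussianReal (μ := 0) (v := v) (X := id) (p := gaussianReal 0 v) (by simp) w
  simp only [mgf, id] at this
  simpa [mul_comm] using this

/-- For variance 1/(2c) the density is proportional to exp(−c g²). The factor exp(c g²/2) cancels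
half of the exponent, which doubles the variance and multiplies the integral by √2. -/
theorem gaussian_exp_sq {c : ℝ} (hc : 0 < c) :
    Integrable (fun g : ℝ => Real.exp (c / 2 * g ^ 2))
        (gaussianReal 0 (Real.toNNReal (1 / (2 * c)))) ∧
      ∫ g, Real.exp (c / 2 * g ^ 2) ∂gaussianReal 0 (Real.toNNReal (1 / (2 * c))) = √2 := by
  set v := Real.toNNReal (1 / (2 * c)) with hv
  have hv' : (v : ℝ) = 1 / (2 * c) := Real.coe_toNNReal _ (by positivity)
  have hv0 : v ≠ 0 := by
    intro h; rw [h] at hv'; simp at hv'; exact hc.ne' hv'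
  have hpt : ∀ g : ℝ, gaussianPDFReal 0 v g * Real.exp (c / 2 * g ^ 2)
      = (√(2 * Real.pi * v))⁻¹ * Real.exp (-(c / 2) * g ^ 2) := by
    intro g
    rw [gaussianPDFReal, mul_assoc, ← Real.exp_add, hv']
    congr 2
    field_simp
    ring
  constructor
  · rw [gaussianReal_of_var_ne_zero _ hv0]
    rw [integrable_withDensity_iff_integrable_smul' (measurable_gaussianPDF 0 v)
      (ae_of_all _ fun x => gaussianPDF_lt_top)]
    simp only [toReal_gaussianPDF, smul_eq_mul, hpt]
    exact (integrable_exp_neg_mul_sq (by positivity)).const_mul _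
  · rw [integral_gaussianReal_eq_integral_smul hv0]
    simp only [smul_eq_mul, hpt]
    rw [integral_const_mul, integral_gaussian, hv', ← div_eq_inv_mul,
      ← Real.sqrt_div' _ (by positivity)]
    congr 1
    field_simp

/-- Write exp(|W|²/(4c)) as the average of exp(g·W) over independent Gaussian g_i of variance
1/(2c), exchange the integrals by Tonelli, and apply the subgaussian bound in each direction g.
Every coordinate contributes a factor √2. -/
theorem lintegral_exp_sum_sq_le {ι Ω : Type*} [Fintype ι] [MeasurableSpace Ω] {μ : Measure Ω}
    [SFinite μ] {W : ι → Ω → ℝ} (hW : ∀ i, Measurable (W i)) {c : ℝ} (hc : 0 < c)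
    (h : ∀ g : ι → ℝ, ∫⁻ ω, ENNReal.ofReal (Real.exp (∑ i, g i * W i ω)) ∂μ
      ≤ ENNReal.ofReal (Real.exp (∑ i, c / 2 * g i ^ 2))) :
    ∫⁻ ω, ENNReal.ofReal (Real.exp (1 / (4 * c) * ∑ i, W i ω ^ 2)) ∂μ
      ≤ ENNReal.ofReal (√2 ^ Fintype.card ι) := by
  set v := Real.toNNReal (1 / (2 * c)) with hv
  have hv' : (v : ℝ) = 1 / (2 * c) := Real.coe_toNNReal _ (by positivity)
  set γ : Measure (ι → ℝ) := Measure.pi fun _ => gaussianReal 0 v with hγ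
  have h1 : ∀ ω, ENNReal.ofReal (Real.exp (1 / (4 * c) * ∑ i, W i ω ^ 2))
      = ∫⁻ g, ENNReal.ofReal (Real.exp (∑ i, g i * W i ω)) ∂γ := by
    intro ω
    have hi : Integrable (fun g : ι → ℝ => ∏ i, Real.exp (g i * W i ω)) γ := by
      refine Integrable.fintype_prod (f := fun i x => Real.exp (x * W i ω)) fun i => ?_
      simpa [mul_comm] using integrable_exp_mul_gaussianReal (μ := 0) (v := v) (W i ω)
    simp only [Real.exp_sum]
    rw [← ofReal_integral_eq_lintegral_ofReal hi
      (ae_of_all _ fun g => Finset.prod_nonneg fun i _ => (Real.exp_pos _).le),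
      integral_fintype_prod_eq_prod (f := fun i x => Real.exp (x * W i ω))]
    simp only [exp_sq_eq_integral_gaussian, hv', Finset.mul_sum, Real.exp_sum]
    congr 1
    refine Finset.prod_congr rfl fun i _ => ?_
    congr 1
    field_simp
    ring
  simp only [h1]
  rw [lintegral_lintegral_swap]
  · refine (lintegral_mono h).trans ?_
    simp only [Real.exp_sum]
    have hi : Integrable (fun g : ι → ℝ => ∏ i, Real.exp (c / 2 * g i ^ 2)) γ :=
      Integrable.fintype_prod (f := fun i x => Real.exp (c / 2 * x ^ 2))
        fun i => (gaussian_exp_sq hc).1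
    rw [← ofReal_integral_eq_lintegral_ofReal hi
      (ae_of_all _ fun g => Finset.prod_nonneg fun i _ => (Real.exp_pos _).le),
      integral_fintype_prod_eq_prod (f := fun i x => Real.exp (c / 2 * x ^ 2))]
    simp only [(gaussian_exp_sq hc).2, hv, Finset.prod_const, Finset.card_univ, le_refl]
  · refine Measurable.aemeasurable ?_
    simp only [Function.uncurry_def]
    fun_prop

/-! ### Maximal tail bound for sums of bounded centered vectors. -/

section Tail

variable {ι : Type*} [Fintype ι] {Ω : Type*} [MeasurableSpace Ω] {μ : Measure Ω}
  [IsProbabilityMeasure μ] {ξ : ℕ × ι → Ω → ℝ}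

/-- In direction g the sum of n independent terms has variance proxy n|g|²/4, so the previous bound
applies with c = n/4, for which 1/(4c) = 1/n. -/
theorem lintegral_exp_sqNormSum_le (hξ : iIndepFun ξ μ) (hm : ∀ p, Measurable (ξ p))
    (hs : ∀ p, HasSubgaussianMGF (ξ p) (1 / 4) μ) {n : ℕ} (hn : 0 < n) :
    ∫⁻ ω, ENNReal.ofReal (Real.exp (1 / (n : ℝ) * sqNormSum (fun p => ξ p ω) n)) ∂μ
      ≤ ENNReal.ofReal (√2 ^ Fintype.card ι) := by
  have hn' : (0 : ℝ) < n := by exact_mod_cast hn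
  have := lintegral_exp_sum_sq_le (μ := μ) (c := n / 4)
    (W := fun i ω => partialSum (fun p => ξ p ω) n i)
    (fun i => (measurable_partialSum n i).comp (measurable_pi_lambda _ hm)) (by positivity)
    fun g => by
      have h1 : iIndepFun (fun p ω => g p.2 * ξ p ω) μ :=
        hξ.comp (fun p x => g p.2 * x) fun p => by fun_prop
      have h2 := HasSubgaussianMGF.sum_of_iIndepFun h1 (s := Finset.range n ×ˢ Finset.univ)
        (c := fun p => (g p.2 ^ 2 / 4).toNNReal) fun p _ => by
          convert (hs p).const_mul (g p.2) using 1
          refine NNReal.eq ?_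
          rw [Real.coe_toNNReal _ (by positivity)]
          change g p.2 ^ 2 / 4 = g p.2 ^ 2 * (((1 / 4 : NNReal)) : ℝ)
          push_cast
          ring
      have h3 := h2.mgf_le 1
      have e : ∀ ω, ∑ p ∈ Finset.range n ×ˢ Finset.univ, g p.2 * ξ p ω
          = ∑ i, g i * partialSum (fun p => ξ p ω) n i := fun ω => by
        rw [Finset.sum_product_right]
        simp [partialSum, Finset.mul_sum]
      have hi := h2.integrable_exp_mul 1
      simp only [mgf, one_mul, e] at h3 hi
      rw [← ofReal_integral_eq_lintegral_ofReal hi (ae_of_all _ fun _ => (Real.exp_pos _).le)]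
      refine ENNReal.ofReal_le_ofReal (h3.trans (le_of_eq ?_))
      congr 1
      rw [Finset.sum_product_right, NNReal.coe_sum, one_pow, mul_one, Finset.sum_div]
      refine Finset.sum_congr rfl fun i _ => ?_
      simp only [Finset.sum_const, Finset.card_range, nsmul_eq_mul, NNReal.coe_mul,
        NNReal.coe_natCast]
      rw [Real.coe_toNNReal _ (by positivity)]
      ring
  have e : 1 / (4 * ((n : ℝ) / 4)) = 1 / n := by field_simp
  rw [e] at this
  exact this

theorem measure_exists_sqNormSum_ge_le (hξ : iIndepFun ξ μ) (hm : ∀ p, Measurable (ξ p))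
    (hb : ∀ p ω, |ξ p ω| ≤ 1) (h0 : ∀ p, ∫ ω, ξ p ω ∂μ = 0)
    (hs : ∀ p, HasSubgaussianMGF (ξ p) (1 / 4) μ) (a : ℝ) {n : ℕ} (hn : 0 < n) :
    μ {ω | ∃ s ≤ n, a ≤ sqNormSum (fun p => ξ p ω) s}
      ≤ ENNReal.ofReal (√2 ^ Fintype.card ι * Real.exp (-(a / n))) := by
  have h1 := measure_exceed_mul_exp_le hξ hm hb h0 (a := a) (l := 1 / n) (by positivity) n
  have hint := integrable_exceed_indicator (μ := μ) hm hb MeasurableSet.univ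
    (l := 1 / n) (by positivity) n
  have h2 : ∫ ω, (exceedSet a n).indicator (fun x => Real.exp (1 / n * sqNormSum x n))
      (fun p => ξ p ω) ∂μ ≤ √2 ^ Fintype.card ι := by
    rw [integral_eq_lintegral_of_nonneg_ae
      (ae_of_all _ fun ω => Set.indicator_nonneg (fun _ _ => (Real.exp_pos _).le) _)
      (integrable_exceed_indicator (μ := μ) hm hb (measurableSet_exceedSet a n)
        (by positivity) n).aestronglyMeasurable]
    refine ENNReal.toReal_le_of_le_ofReal (by positivity) ?_
    refine (lintegral_mono fun ω => ?_).trans (lintegral_exp_sqNormSum_le hξ hm hs hn)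
    exact ENNReal.ofReal_le_ofReal (Set.indicator_le_self' (fun _ _ => (Real.exp_pos _).le) _)
  have h3 : μ.real ((fun ω p => ξ p ω) ⁻¹' exceedSet a n)
      ≤ √2 ^ Fintype.card ι * Real.exp (-(a / n)) := by
    rw [Real.exp_neg, ← div_eq_mul_inv, le_div_iff₀ (Real.exp_pos _)]
    have e : (1 / (n : ℝ)) * a = a / n := by ring
    rw [e] at h1
    linarith
  rw [← ofReal_measureReal]
  exact ENNReal.ofReal_le_ofReal h3

end Tail

/-! ### Deviation bounds over all times. -/

section Uniform

variable {m : ℕ} {Ω : Type*} [MeasurableSpace Ω] {μ : Measure Ω}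
  [IsProbabilityMeasure μ] {ξ : ℕ × (Fin m × Fin m) → Ω → ℝ}

theorem sqrt_two_pow_le_exp (k : ℕ) : √2 ^ k ≤ Real.exp k := by
  rw [← Real.exp_one_pow]
  gcongr
  have h1 : √2 ≤ 2 := by
    rw [Real.sqrt_le_left (by norm_num)]; norm_num
  linarith [Real.add_one_le_exp (1 : ℝ)]

/-- With probability at least `1 - 2 exp (-L)`, the squared norm of the partial sums stays below
a multiple of `s ^ (3 / 2)` simultaneously at all times `s ≥ A / ε ^ 2`. -/
theorem measure_exists_sq_sqNormSum_ge_le (hξ : iIndepFun ξ μ) (hm : ∀ p, Measurable (ξ p))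
    (hb : ∀ p ω, |ξ p ω| ≤ 1) (h0 : ∀ p, ∫ ω, ξ p ω ∂μ = 0)
    (hs : ∀ p, HasSubgaussianMGF (ξ p) (1 / 4) μ) (hm0 : 0 < m) {ε L A : ℝ} (hε : 0 < ε)
    (hε1 : ε ≤ 1) (hL : 0 < L) (hA : A = 80 * ((m : ℝ) ^ 2 + 3 * L)) :
    μ {ω | ∃ s : ℕ, A / ε ^ 2 ≤ s ∧
        (25 / 98) ^ 2 * (s : ℝ) ^ 3 * A * (m : ℝ) ^ 2 * ε ^ 2
          ≤ sqNormSum (fun p => ξ p ω) s ^ 2}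
      ≤ ENNReal.ofReal (2 * Real.exp (-L)) := by
  have hm1 : (1 : ℝ) ≤ m := by exact_mod_cast hm0
  have hA80 : 80 ≤ A := by rw [hA]; nlinarith
  set S := A / ε ^ 2 with hS
  have hS1 : 1 ≤ S := by
    rw [hS, le_div_iff₀ (by positivity)]
    nlinarith
  -- Block `k` consists of the times with 4^k S ≤ s < 4^(k+1) S. The level `a k` is chosen so that
  -- its square is the threshold of the statement at the left end of the block.
  set a : ℕ → ℝ := fun k => 25 / 98 * m * A ^ 2 * 8 ^ k / ε ^ 2 with ha
  set n : ℕ → ℕ := fun k => ⌊4 ^ (k + 1) * S⌋₊ with hn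
  have hn0 : ∀ k, 0 < n k := fun k => by
    rw [hn, Nat.floor_pos]
    have : (1 : ℝ) ≤ 4 ^ (k + 1) := one_le_pow₀ (by norm_num)
    nlinarith
  have hterm : ∀ k, μ {ω | ∃ s ≤ n k, a k ≤ sqNormSum (fun p => ξ p ω) s}
      ≤ ENNReal.ofReal (Real.exp (-L) * (1 / 2) ^ k) := by
    intro k
    refine (measure_exists_sqNormSum_ge_le hξ hm hb h0 hs (a k) (hn0 k)).trans
      (ENNReal.ofReal_le_ofReal ?_)
    have hn0' : (0 : ℝ) < n k := by exact_mod_cast hn0 k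
    -- As 25/98 > 1/4 and m ≥ 1, the ratio is at least A 2^k / 16 = 5 (m² + 3L) 2^k, which is where
    -- A = 80 (m² + 3L) enters.
    have h1 : 5 * ((m : ℝ) ^ 2 + 3 * L) * (k + 1) ≤ a k / n k := by
      rw [le_div_iff₀ hn0']
      have hle : (n k : ℝ) ≤ 4 ^ (k + 1) * S := Nat.floor_le (by positivity)
      have hk : (k : ℝ) + 1 ≤ 2 ^ k := by
        have := one_add_mul_le_pow (a := (1 : ℝ)) (by norm_num) k
        norm_num at this; linarith
      calc 5 * ((m : ℝ) ^ 2 + 3 * L) * (k + 1) * n k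
          ≤ 5 * ((m : ℝ) ^ 2 + 3 * L) * 2 ^ k * (4 ^ (k + 1) * S) := by gcongr
        _ = 1 / 4 * A ^ 2 * 8 ^ k / ε ^ 2 := by
            have e8 : (8 : ℝ) ^ k = 2 ^ k * 4 ^ k := by rw [← mul_pow]; norm_num
            rw [hS, e8, pow_succ (4 : ℝ) k]
            have : ((m : ℝ) ^ 2 + 3 * L) = A / 80 := by rw [hA]; ring
            rw [this]; ring
        _ ≤ a k := by
            rw [ha]
            simp only
            gcongr
            nlinarith [sq_nonneg A]
    calc √2 ^ Fintype.card (Fin m × Fin m) * Real.exp (-(a k / n k))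
        ≤ Real.exp ((m : ℝ) ^ 2) * Real.exp (-(5 * ((m : ℝ) ^ 2 + 3 * L) * (k + 1))) := by
          have h2 := sqrt_two_pow_le_exp (Fintype.card (Fin m × Fin m))
          have e : ((Fintype.card (Fin m × Fin m) : ℕ) : ℝ) = (m : ℝ) ^ 2 := by simp [sq]
          rw [e] at h2
          gcongr
      _ ≤ Real.exp (-L) * Real.exp (-1) ^ k := by
          rw [← Real.exp_add, ← Real.exp_nat_mul, ← Real.exp_add]
          refine Real.exp_le_exp.2 ?_
          have hk0 : (0 : ℝ) ≤ k := Nat.cast_nonneg k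
          nlinarith [mul_nonneg hk0 hL.le, mul_nonneg hk0 (by nlinarith : 0 ≤ (m : ℝ) ^ 2 - 1)]
      _ ≤ _ := by
          gcongr
          rw [Real.exp_neg, one_div]
          refine inv_anti₀ (by norm_num) ?_
          linarith [Real.add_one_le_exp (1 : ℝ)]
  have hsub : {ω | ∃ s : ℕ, S ≤ s ∧ (25 / 98) ^ 2 * (s : ℝ) ^ 3 * A * (m : ℝ) ^ 2 * ε ^ 2
          ≤ sqNormSum (fun p => ξ p ω) s ^ 2}
      ⊆ ⋃ k, {ω | ∃ s ≤ n k, a k ≤ sqNormSum (fun p => ξ p ω) s} := by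
    rintro ω ⟨s, hs1, hs2⟩
    obtain ⟨k, hk1, hk2⟩ := exists_nat_pow_near (y := (4 : ℝ))
      (show (1 : ℝ) ≤ s / S by rwa [le_div_iff₀ (by positivity), one_mul]) (by norm_num)
    rw [le_div_iff₀ (by positivity)] at hk1
    rw [div_lt_iff₀ (by positivity)] at hk2
    refine Set.mem_iUnion.2 ⟨k, s, Nat.le_floor hk2.le, ?_⟩
    refine le_of_sq_le_sq ?_ (sqNormSum_nonneg _ _)
    refine le_trans ?_ hs2
    calc a k ^ 2 = (25 / 98) ^ 2 * (4 ^ k * S) ^ 3 * A * (m : ℝ) ^ 2 * ε ^ 2 := by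
          have e64 : ((8 : ℝ) ^ k) ^ 2 = (4 ^ k) ^ 3 := by
            rw [← pow_mul, ← pow_mul, mul_comm k 2, mul_comm k 3, pow_mul, pow_mul]; norm_num
          rw [ha, hS]
          simp only [div_pow, mul_pow, e64]
          field_simp
      _ ≤ _ := by gcongr
  refine (measure_mono hsub).trans ((measure_iUnion_le _).trans ?_)
  refine (ENNReal.tsum_le_tsum hterm).trans ?_
  rw [← ENNReal.ofReal_tsum_of_nonneg (fun k => by positivity)
    (summable_geometric_two.mul_left _), tsum_mul_left, tsum_geometric_two, mul_comm]

/-- At a single time s the tail is at most exp(m² − σ² s/8). Starting at s₁ ≥ 8m²/σ² absorbs the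
term m² and leaves a geometric series of ratio exp(−σ²/8). -/
theorem tsum_measure_sqNormSum_ge_le (hξ : iIndepFun ξ μ) (hm : ∀ p, Measurable (ξ p))
    (hb : ∀ p ω, |ξ p ω| ≤ 1) (h0 : ∀ p, ∫ ω, ξ p ω ∂μ = 0)
    (hs : ∀ p, HasSubgaussianMGF (ξ p) (1 / 4) μ) {σ : ℝ} (hσ : 0 < σ) {s₁ : ℕ}
    (hs0 : 0 < s₁) (hs1 : 8 * (m : ℝ) ^ 2 / σ ^ 2 ≤ s₁) :
    ∑' k : ℕ, μ {ω | σ ^ 2 * ((s₁ + k : ℕ) : ℝ) ^ 2 / 8 ≤ sqNormSum (fun p => ξ p ω) (s₁ + k)}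
      ≤ ENNReal.ofReal (1 + 8 / σ ^ 2) := by
  have hterm : ∀ k : ℕ,
      μ {ω | σ ^ 2 * ((s₁ + k : ℕ) : ℝ) ^ 2 / 8 ≤ sqNormSum (fun p => ξ p ω) (s₁ + k)}
      ≤ ENNReal.ofReal (Real.exp (-(σ ^ 2 / 8)) ^ k) := by
    intro k
    have hpos : 0 < s₁ + k := by omega
    refine (measure_mono ?_).trans ((measure_exists_sqNormSum_ge_le hξ hm hb h0 hs
      (σ ^ 2 * ((s₁ + k : ℕ) : ℝ) ^ 2 / 8) hpos).trans (ENNReal.ofReal_le_ofReal ?_))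
    · intro ω h
      exact ⟨s₁ + k, le_rfl, h⟩
    · have h2 := sqrt_two_pow_le_exp (Fintype.card (Fin m × Fin m))
      have e : ((Fintype.card (Fin m × Fin m) : ℕ) : ℝ) = (m : ℝ) ^ 2 := by simp [sq]
      rw [e] at h2
      have hpos' : (0 : ℝ) < ((s₁ + k : ℕ) : ℝ) := by exact_mod_cast hpos
      have e2 : σ ^ 2 * ((s₁ + k : ℕ) : ℝ) ^ 2 / 8 / ((s₁ + k : ℕ) : ℝ)
          = σ ^ 2 / 8 * (s₁ + k) := by
        push_cast at hpos' ⊢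
        field_simp
      rw [e2]
      refine (mul_le_mul_of_nonneg_right h2 (Real.exp_pos _).le).trans ?_
      rw [← Real.exp_add, ← Real.exp_nat_mul]
      refine Real.exp_le_exp.2 ?_
      rw [div_le_iff₀ (by positivity)] at hs1
      nlinarith
  have hx1 : Real.exp (-(σ ^ 2 / 8)) < 1 := by
    rw [Real.exp_lt_one_iff]; simp only [neg_neg_iff_pos]; positivity
  refine (ENNReal.tsum_le_tsum hterm).trans ?_
  rw [← ENNReal.ofReal_tsum_of_nonneg (fun k => by positivity)
    (summable_geometric_of_lt_one (Real.exp_pos _).le hx1),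
    tsum_geometric_of_lt_one (Real.exp_pos _).le hx1]
  refine ENNReal.ofReal_le_ofReal ?_
  -- With x = σ²/8, the inequality e^x ≥ 1 + x gives 1/(1 − e^(−x)) ≤ 1 + 1/x.
  have h3 : Real.exp (-(σ ^ 2 / 8)) ≤ (1 + σ ^ 2 / 8)⁻¹ := by
    rw [Real.exp_neg]
    refine inv_anti₀ (by positivity) ?_
    linarith [Real.add_one_le_exp (σ ^ 2 / 8)]
  rw [inv_le_comm₀ (by linarith) (by positivity)]
  have e : (1 + 8 / σ ^ 2)⁻¹ = 1 - (1 + σ ^ 2 / 8)⁻¹ := by field_simp; ring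
  rw [e]
  linarith

end Uniform

/-! ### The least singular value -/

section SingularValue

open scoped InnerProductSpace

variable {m : ℕ}

theorem toEuclideanLin_toLp (A : Matrix (Fin m) (Fin m) ℝ) (x : Fin m → ℝ) :
    Matrix.toEuclideanLin A (WithLp.toLp 2 x) = WithLp.toLp 2 (A.mulVec x) := rfl

theorem norm_toLp_sq (x : Fin m → ℝ) : ‖WithLp.toLp 2 x‖ ^ 2 = x ⬝ᵥ x := by
  rw [EuclideanSpace.norm_sq_eq]
  simp [dotProduct, sq]

theorem mul_norm_sq_le_inner_of_le_eigenvalues {E : Type*} [NormedAddCommGroup E]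
    [InnerProductSpace ℝ E] [FiniteDimensional ℝ E] {S : E →ₗ[ℝ] E} (hS : S.IsSymmetric)
    {n : ℕ} (hn : Module.finrank ℝ E = n) {c : ℝ} (hc : ∀ i, c ≤ hS.eigenvalues hn i) (x : E) :
    c * ‖x‖ ^ 2 ≤ ⟪x, S x⟫_ℝ := by
  set b := hS.eigenvectorBasis hn
  have h1 : ⟪x, S x⟫_ℝ = ∑ i, hS.eigenvalues hn i * ⟪b i, x⟫_ℝ ^ 2 := by
    rw [← b.sum_inner_mul_inner]
    refine Finset.sum_congr rfl fun i _ => ?_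
    rw [← hS, hS.apply_eigenvectorBasis, inner_smul_left, real_inner_comm x]
    simp only [RCLike.ofReal_real_eq_id, id, conj_trivial]
    ring
  rw [h1, ← b.sum_sq_norm_inner_right x, Finset.mul_sum]
  refine Finset.sum_le_sum fun i _ => ?_
  rw [Real.norm_eq_abs, sq_abs]
  exact mul_le_mul_of_nonneg_right (hc i) (sq_nonneg _)

theorem leastSingularValue_nonneg (A : Matrix (Fin m) (Fin m) ℝ) : 0 ≤ leastSingularValue A :=
  LinearMap.singularValues_nonneg _ _

theorem leastSingularValue_mul_norm_le (hm : 0 < m) (A : Matrix (Fin m) (Fin m) ℝ)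
    (x : Fin m → ℝ) :
    leastSingularValue A * ‖WithLp.toLp 2 x‖ ≤ ‖WithLp.toLp 2 (A.mulVec x)‖ := by
  set T := Matrix.toEuclideanLin A with hT
  have hn : Module.finrank ℝ (EuclideanSpace ℝ (Fin m)) = m := by simp
  have hlt : m - 1 < m := by omega
  have h := mul_norm_sq_le_inner_of_le_eigenvalues T.isSymmetric_adjoint_comp_self hn
    (c := leastSingularValue A ^ 2) (fun i => by
      rw [leastSingularValue, LinearMap.sq_singularValues_of_lt _ hn hlt]
      exact T.isSymmetric_adjoint_comp_self.eigenvalues_antitone hn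
        (Fin.le_def.2 (Nat.le_sub_one_of_lt i.2))) (WithLp.toLp 2 x)
  rw [LinearMap.comp_apply, LinearMap.adjoint_inner_right, real_inner_self_eq_norm_sq,
    ← mul_pow] at h
  exact le_of_sq_le_sq h (norm_nonneg _)

theorem exists_norm_mulVec_eq_leastSingularValue (hm : 0 < m) (A : Matrix (Fin m) (Fin m) ℝ) :
    ∃ x : Fin m → ℝ, ‖WithLp.toLp 2 x‖ = 1 ∧
      ‖WithLp.toLp 2 (A.mulVec x)‖ = leastSingularValue A := by
  set T := Matrix.toEuclideanLin A with hT
  have hn : m - 1 < Module.finrank ℝ (EuclideanSpace ℝ (Fin m)) := by simp; omega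
  obtain ⟨v, hv⟩ := (T.hasEigenvalue_adjoint_comp_self_sq_singularValues hn).exists_hasEigenvector
  have hv0 : ‖v‖ ≠ 0 := norm_ne_zero_iff.2 hv.2
  have h1 : ‖T v‖ ^ 2 = (leastSingularValue A * ‖v‖) ^ 2 := by
    rw [← real_inner_self_eq_norm_sq, ← LinearMap.adjoint_inner_right, ← LinearMap.comp_apply,
      hv.apply_eq_smul, inner_smul_right, real_inner_self_eq_norm_sq, mul_pow]
    rfl
  have h2 : ‖T v‖ = leastSingularValue A * ‖v‖ := by
    rwa [sq_eq_sq₀ (norm_nonneg _)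
      (mul_nonneg (leastSingularValue_nonneg A) (norm_nonneg _))] at h1
  refine ⟨(‖v‖⁻¹ • v).ofLp, ?_, ?_⟩
  · rw [WithLp.toLp_ofLp, norm_smul, norm_inv, norm_norm, inv_mul_cancel₀ hv0]
  · rw [← toEuclideanLin_toLp, WithLp.toLp_ofLp, map_smul, norm_smul, norm_inv, norm_norm, h2]
    field_simp

theorem norm_mulVec_le_of_sum_sq_le (B : Matrix (Fin m) (Fin m) ℝ) {e : ℝ} (he : 0 ≤ e)
    (hB : ∑ i, ∑ j, B i j ^ 2 ≤ e ^ 2) (x : Fin m → ℝ) :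
    ‖WithLp.toLp 2 (B.mulVec x)‖ ≤ e * ‖WithLp.toLp 2 x‖ := by
  refine le_of_sq_le_sq ?_ (by positivity)
  rw [mul_pow, norm_toLp_sq, norm_toLp_sq]
  calc (B.mulVec x) ⬝ᵥ (B.mulVec x) = ∑ i, (∑ j, B i j * x j) ^ 2 := by
        simp [dotProduct, Matrix.mulVec, sq]
    _ ≤ ∑ i, (∑ j, B i j ^ 2) * ∑ j, x j ^ 2 :=
        Finset.sum_le_sum fun i _ => Finset.sum_mul_sq_le_sq_mul_sq _ _ _
    _ = (∑ i, ∑ j, B i j ^ 2) * (x ⬝ᵥ x) := by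
        rw [← Finset.sum_mul]; simp [dotProduct, sq]
    _ ≤ _ := mul_le_mul_of_nonneg_right hB
        (by rw [← norm_toLp_sq]; positivity)

/-- Weyl's inequality with the Frobenius norm: test `A` on a unit vector at which `B` attains its
least singular value. -/
theorem leastSingularValue_le_add (hm : 0 < m) (A B : Matrix (Fin m) (Fin m) ℝ) {e : ℝ}
    (he : 0 ≤ e) (h : ∑ i, ∑ j, (A - B) i j ^ 2 ≤ e ^ 2) :
    leastSingularValue A ≤ leastSingularValue B + e := by
  obtain ⟨x, hx1, hx2⟩ := exists_norm_mulVec_eq_leastSingularValue hm B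
  have h1 := leastSingularValue_mul_norm_le hm A x
  have h2 := norm_mulVec_le_of_sum_sq_le (A - B) he h x
  have h3 : WithLp.toLp 2 (A.mulVec x)
      = WithLp.toLp 2 (B.mulVec x) + WithLp.toLp 2 ((A - B).mulVec x) := by
    rw [Matrix.sub_mulVec, ← WithLp.toLp_add, add_sub_cancel]
  have h4 := norm_add_le (WithLp.toLp 2 (B.mulVec x)) (WithLp.toLp 2 ((A - B).mulVec x))
  rw [← h3] at h4
  rw [hx1] at h1 h2
  linarith

/-- The image of a basis vector is a column, whose squared norm is at most `m`. -/
theorem leastSingularValue_sq_le_of_abs_le_one (hm : 0 < m) (A : Matrix (Fin m) (Fin m) ℝ)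
    (hA : ∀ i j, |A i j| ≤ 1) : leastSingularValue A ^ 2 ≤ m := by
  have h1 := leastSingularValue_mul_norm_le hm A (Pi.single ⟨0, hm⟩ 1)
  have h2 := pow_le_pow_left₀
    (mul_nonneg (leastSingularValue_nonneg A) (norm_nonneg _)) h1 2
  rw [mul_pow, norm_toLp_sq, norm_toLp_sq] at h2
  simp only [Matrix.mulVec_single_one, dotProduct_single, Pi.single_eq_same, mul_one] at h2
  refine h2.trans ?_
  simp only [dotProduct, Matrix.col_apply, ← sq]
  refine (Finset.sum_le_sum fun i _ => (sq_le_one_iff_abs_le_one _).2 (hA i _)).trans (by simp)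

theorem isUnit_det_of_leastSingularValue_pos (hm : 0 < m) (A : Matrix (Fin m) (Fin m) ℝ)
    (h : 0 < leastSingularValue A) : IsUnit A.det := by
  rw [isUnit_iff_ne_zero]
  intro h0
  obtain ⟨v, hv, hv0⟩ := Matrix.exists_mulVec_eq_zero_iff.2 h0
  have h1 := leastSingularValue_mul_norm_le hm A v
  rw [hv0, WithLp.toLp_zero, norm_zero] at h1
  have h2 : 0 < ‖WithLp.toLp 2 v‖ := norm_pos_iff.2 (by simpa using hv)
  nlinarith

/-- Eigenvalues of a positive semidefinite matrix are nonnegative, so each equals the norm of the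
image of a unit eigenvector and is at least the least singular value. -/
theorem leastSingularValue_mul_dotProduct_le (hm : 0 < m) {C : Matrix (Fin m) (Fin m) ℝ}
    (hC : C.PosSemidef) (x : Fin m → ℝ) :
    leastSingularValue C * (x ⬝ᵥ x) ≤ x ⬝ᵥ C.mulVec x := by
  set T := Matrix.toEuclideanLin C with hT
  have hS : T.IsSymmetric := Matrix.isSymmetric_toEuclideanLin_iff.2 hC.1
  have hn : Module.finrank ℝ (EuclideanSpace ℝ (Fin m)) = m := by simp
  have hin : ∀ y : EuclideanSpace ℝ (Fin m), ⟪y, T y⟫_ℝ = y.ofLp ⬝ᵥ C.mulVec y.ofLp := fun y => by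
    rw [EuclideanSpace.inner_eq_star_dotProduct, dotProduct_comm]
    rfl
  have h := mul_norm_sq_le_inner_of_le_eigenvalues hS hn (c := leastSingularValue C)
    (fun i => by
      set v := hS.eigenvectorBasis hn i with hv
      have hv1 : ‖v‖ = 1 := (hS.eigenvectorBasis hn).norm_eq_one i
      have hTv : T v = hS.eigenvalues hn i • v := by
        rw [hv, hS.apply_eigenvectorBasis]; rfl
      have h0 : 0 ≤ hS.eigenvalues hn i := by
        have h1 := hC.dotProduct_mulVec_nonneg v.ofLp
        rw [star_trivial, ← hin, hTv, inner_smul_right, real_inner_self_eq_norm_sq, hv1] at h1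
        simpa using h1
      have h1 := leastSingularValue_mul_norm_le hm C v.ofLp
      rw [← toEuclideanLin_toLp, WithLp.toLp_ofLp, ← hT, hTv, norm_smul, hv1, mul_one, mul_one,
        Real.norm_of_nonneg h0] at h1
      exact h1) (WithLp.toLp 2 x)
  rwa [norm_toLp_sq, hin] at h

end SingularValue

/-! ### Moments of pairing products in the Gaussian model -/

section Moments

variable {n : ℕ}

/-- Diagonal entries never occur, so the product has one factor per independent coordinate and its
moments factor. -/
theorem pairingProduct_covMatrix {p : Finset (Sym2 (Fin n))} (hp : ∀ e ∈ p, ¬ e.IsDiag)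
    (w : Edge n → ℝ) :
    pairingProduct p (covMatrix w) = ∏ e : Edge n, if e.1 ∈ p then w e else 1 := by
  classical
  have hentry : ∀ e : Edge n, covMatrix w e.1.inf e.1.sup = w e := by
    rintro ⟨e, he⟩
    induction e with | _ i j =>
    have hij : i ≠ j := by simpa using he
    rcases lt_or_gt_of_ne hij with h | h
    · simp [covMatrix, offDiag, hij, h.le, inf_of_le_left, sup_of_le_right]
    · simp [covMatrix, offDiag, hij.symm, h.le, inf_of_le_right, sup_of_le_left, Sym2.eq_swap]
  rw [← Finset.prod_filter, pairingProduct]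
  refine Finset.prod_bij' (fun e he => (⟨e, hp e he⟩ : Edge n)) (fun e _ => e.1) ?_ ?_ ?_ ?_ ?_
  · intro e he; simpa using he
  · intro e he; simpa using he
  · intro e he; rfl
  · intro e he; rfl
  · intro e he; exact hentry ⟨e, hp e he⟩

theorem integrable_pow_gaussian (k : ℕ) : Integrable (fun x : ℝ => x ^ k) (gaussianReal 0 1) := by
  refine (memLp_id_gaussianReal (μ := 0) (v := 1) k).integrable_norm_pow'.mono' (by fun_prop)
    (ae_of_all _ fun x => by simp)

theorem integral_sq_gaussian : ∫ x, x ^ 2 ∂gaussianReal 0 1 = 1 := by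
  have h := variance_id_gaussianReal (μ := 0) (v := 1)
  rw [variance_eq_sub (memLp_id_gaussianReal 2)] at h
  simpa [integral_id_gaussianReal] using h

theorem integrable_pairingProduct_mul {p q : Finset (Sym2 (Fin n))} (hp : ∀ e ∈ p, ¬ e.IsDiag)
    (hq : ∀ e ∈ q, ¬ e.IsDiag) :
    Integrable (fun w => pairingProduct p (covMatrix w) * pairingProduct q (covMatrix w))
      (gaussianWeights n) := by
  simp only [pairingProduct_covMatrix hp, pairingProduct_covMatrix hq, ← Finset.prod_mul_distrib]
  unfold gaussianWeights
  refine Integrable.fintype_prod (μ := fun _ : Edge n => gaussianReal 0 1)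
    (f := fun (e : Edge n) (x : ℝ) =>
      (if e.1 ∈ p then x else 1) * (if e.1 ∈ q then x else 1)) fun e => ?_
  by_cases h1 : e.1 ∈ p <;> by_cases h2 : e.1 ∈ q <;> simp only [h1, h2, if_true, if_false]
  · simpa [sq] using integrable_pow_gaussian 2
  · simpa using integrable_pow_gaussian 1
  · simpa using integrable_pow_gaussian 1
  · simp

/-- Orthonormality of the monomials: a coordinate occurring in both contributes its second moment 1,
and a coordinate occurring in exactly one contributes its mean 0. -/
theorem integral_pairingProduct_mul {p q : Finset (Sym2 (Fin n))} (hp : ∀ e ∈ p, ¬ e.IsDiag)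
    (hq : ∀ e ∈ q, ¬ e.IsDiag) :
    ∫ w, pairingProduct p (covMatrix w) * pairingProduct q (covMatrix w) ∂gaussianWeights n
      = if p = q then 1 else 0 := by
  simp only [pairingProduct_covMatrix hp, pairingProduct_covMatrix hq, ← Finset.prod_mul_distrib]
  rw [gaussianWeights, integral_fintype_prod_eq_prod (μ := fun _ : Edge n => gaussianReal 0 1)
    (f := fun e x => (if e.1 ∈ p then x else 1) * (if e.1 ∈ q then x else 1))]
  have hterm : ∀ e : Edge n, ∫ x, (if e.1 ∈ p then x else 1) * (if e.1 ∈ q then x else 1)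
      ∂gaussianReal 0 1 = if (e.1 ∈ p ↔ e.1 ∈ q) then 1 else 0 := by
    intro e
    by_cases h1 : e.1 ∈ p <;> by_cases h2 : e.1 ∈ q <;> simp only [h1, h2, if_true, if_false]
    · simpa [sq] using integral_sq_gaussian
    · simp
    · simp
    · simp
  simp only [hterm]
  split_ifs with h
  · simp [h]
  · have : ∃ e : Edge n, ¬ (e.1 ∈ p ↔ e.1 ∈ q) := by
      by_contra! hc
      refine h (Finset.ext fun e => ?_)
      by_cases he : e.IsDiag
      · exact iff_of_false (fun h' => hp e h' he) (fun h' => hq e h' he)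
      · exact hc ⟨e, he⟩
    obtain ⟨e, he⟩ := this
    exact Finset.prod_eq_zero (Finset.mem_univ e) (by simp [he])

theorem measurable_pairingProduct {p : Finset (Sym2 (Fin n))} (hp : ∀ e ∈ p, ¬ e.IsDiag) :
    Measurable fun w : Edge n → ℝ => pairingProduct p (covMatrix w) := by
  simp only [pairingProduct_covMatrix hp]
  refine Finset.measurable_fun_prod _ fun e _ => ?_
  split_ifs <;> fun_prop

theorem memLp_pairingProduct {p : Finset (Sym2 (Fin n))} (hp : ∀ e ∈ p, ¬ e.IsDiag) :
    MemLp (fun w => pairingProduct p (covMatrix w)) 2 (gaussianWeights n) := by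
  rw [memLp_two_iff_integrable_sq (measurable_pairingProduct hp).aestronglyMeasurable]
  simpa only [sq] using integrable_pairingProduct_mul hp hp

theorem integral_pairingProduct {p : Finset (Sym2 (Fin n))} (hp : ∀ e ∈ p, ¬ e.IsDiag)
    (hne : p.Nonempty) : ∫ w, pairingProduct p (covMatrix w) ∂gaussianWeights n = 0 := by
  -- The empty product is the constant 1, so the mean is an inner product with it.
  have := integral_pairingProduct_mul hp (q := ∅) (by simp)
  simpa [pairingProduct, hne.ne_empty] using this

/-- The linear combination of pairing products with coefficients `a`. -/
noncomputable def pairingComb (a : Finset (Sym2 (Fin n)) → ℝ) (w : Edge n → ℝ) : ℝ :=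
  ∑ p ∈ allPairings Finset.univ, a p * pairingProduct p (covMatrix w)

theorem mem_allPairings {K : Finset (Fin n)} {p : Finset (Sym2 (Fin n))} :
    p ∈ allPairings K ↔ IsPairing K p := by simp [allPairings]

theorem not_isDiag_of_mem_allPairings {K : Finset (Fin n)} {p : Finset (Sym2 (Fin n))}
    (h : p ∈ allPairings K) : ∀ e ∈ p, ¬ e.IsDiag := fun e he => ((mem_allPairings.1 h).1 e he).1

theorem memLp_pairingComb (a : Finset (Sym2 (Fin n)) → ℝ) :
    MemLp (pairingComb a) 2 (gaussianWeights n) :=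
  memLp_finsetSum _ fun p hp =>
    (memLp_pairingProduct (not_isDiag_of_mem_allPairings hp)).const_mul (a p)

theorem integral_pairingComb_mul (a b : Finset (Sym2 (Fin n)) → ℝ) :
    ∫ w, pairingComb a w * pairingComb b w ∂gaussianWeights n
      = ∑ p ∈ allPairings Finset.univ, a p * b p := by
  have e : ∀ w, pairingComb a w * pairingComb b w
      = ∑ p ∈ allPairings Finset.univ, ∑ q ∈ allPairings Finset.univ,
        a p * b q * (pairingProduct p (covMatrix w) * pairingProduct q (covMatrix w)) := fun w => by
    rw [pairingComb, pairingComb, Finset.sum_mul_sum]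
    exact Finset.sum_congr rfl fun p _ => Finset.sum_congr rfl fun q _ => by ring
  simp only [e]
  have hi : ∀ p ∈ allPairings (Finset.univ : Finset (Fin n)), ∀ q ∈ allPairings Finset.univ,
      Integrable (fun w => a p * b q
        * (pairingProduct p (covMatrix w) * pairingProduct q (covMatrix w))) (gaussianWeights n) :=
    fun p hp q hq => (integrable_pairingProduct_mul (not_isDiag_of_mem_allPairings hp)
      (not_isDiag_of_mem_allPairings hq)).const_mul _
  rw [integral_finsetSum _ fun p hp => integrable_finsetSum _ fun q hq => hi p hp q hq]
  refine Finset.sum_congr rfl fun p hp => ?_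
  rw [integral_finsetSum _ fun q hq => hi p hp q hq]
  rw [Finset.sum_eq_single p]
  · rw [integral_const_mul, integral_pairingProduct_mul (not_isDiag_of_mem_allPairings hp)
      (not_isDiag_of_mem_allPairings hp), if_pos rfl, mul_one]
  · intro q hq hqp
    rw [integral_const_mul, integral_pairingProduct_mul (not_isDiag_of_mem_allPairings hp)
      (not_isDiag_of_mem_allPairings hq), if_neg hqp.symm, mul_zero]
  · exact fun h => absurd hp h

theorem IsPairing.nonempty {K : Finset (Fin n)} {p : Finset (Sym2 (Fin n))} (h : IsPairing K p)
    (hK : K.Nonempty) : p.Nonempty := by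
  obtain ⟨x, hx⟩ := hK
  obtain ⟨e, he, -⟩ := h.2 x hx
  exact ⟨e, he.1⟩

/-- Positivity of `n` excludes the empty pairing, whose monomial is the constant 1. -/
theorem integral_pairingComb (hn : 0 < n) (a : Finset (Sym2 (Fin n)) → ℝ) :
    ∫ w, pairingComb a w ∂gaussianWeights n = 0 := by
  have : IsProbabilityMeasure (gaussianWeights n) := by unfold gaussianWeights; infer_instance
  simp only [pairingComb]
  rw [integral_finsetSum _ fun p hp => ((memLp_pairingProduct
    (not_isDiag_of_mem_allPairings hp)).integrable (by norm_num)).const_mul _]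
  refine Finset.sum_eq_zero fun p hp => ?_
  rw [integral_const_mul, integral_pairingProduct (not_isDiag_of_mem_allPairings hp)
    ((mem_allPairings.1 hp).nonempty ⟨⟨0, hn⟩, Finset.mem_univ _⟩), mul_zero]

theorem pairingSum_eq_pairingComb {S : Finset (Finset (Sym2 (Fin n)))}
    (hS : S ⊆ allPairings Finset.univ) (w : Edge n → ℝ) :
    pairingSum S (covMatrix w) = pairingComb (fun p => if p ∈ S then 1 else 0) w := by
  rw [pairingSum, pairingComb]
  simp only [ite_mul, one_mul, zero_mul]
  rw [← Finset.sum_filter, Finset.filter_mem_eq_inter, Finset.inter_eq_right.2 hS]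

theorem target_eq_pairingComb : (target : (Edge n → ℝ) → ℝ) = pairingComb fun _ => 1 := by
  funext w
  simp [target, hafnian, pairingSum, pairingComb]

end Moments

/-! ### Pairing structures represent pairings -/

section Structures

variable {n : ℕ}

theorem isPairing_base {i j : Fin n} (h : i ≠ j) : IsPairing {i, j} {s(i, j)} := by
  refine ⟨fun e he => ?_, fun x hx => ⟨s(i, j), ?_, ?_⟩⟩
  · rw [Finset.mem_singleton] at he
    subst he
    simpa using h
  · simpa using hx
  · rintro e ⟨he, -⟩
    simpa using he

theorem IsPairing.union {K L : Finset (Fin n)} {p q : Finset (Sym2 (Fin n))} (hp : IsPairing K p)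
    (hq : IsPairing L q) (h : Disjoint K L) : IsPairing (K ∪ L) (p ∪ q) := by
  refine ⟨fun e he => ?_, fun x hx => ?_⟩
  · rcases Finset.mem_union.1 he with he | he
    · exact ⟨(hp.1 e he).1, fun x hx => Finset.mem_union_left _ ((hp.1 e he).2 x hx)⟩
    · exact ⟨(hq.1 e he).1, fun x hx => Finset.mem_union_right _ ((hq.1 e he).2 x hx)⟩
  · rcases Finset.mem_union.1 hx with hx | hx
    · obtain ⟨e, he, hu⟩ := hp.2 x hx
      refine ⟨e, ⟨Finset.mem_union_left _ he.1, he.2⟩, fun e' he' => ?_⟩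
      rcases Finset.mem_union.1 he'.1 with h' | h'
      · exact hu e' ⟨h', he'.2⟩
      · exact absurd ((hq.1 e' h').2 x he'.2) (Finset.disjoint_left.1 h hx)
    · obtain ⟨e, he, hu⟩ := hq.2 x hx
      refine ⟨e, ⟨Finset.mem_union_right _ he.1, he.2⟩, fun e' he' => ?_⟩
      rcases Finset.mem_union.1 he'.1 with h' | h'
      · exact absurd hx (Finset.disjoint_left.1 h ((hp.1 e' h').2 x he'.2))
      · exact hu e' ⟨h', he'.2⟩

namespace PairingTree

theorem isPairing_of_mem_pairings {T : PairingTree n} (hT : T.WellFormed) :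
    ∀ p ∈ T.pairings, IsPairing T.index p := by
  induction T with
  | base i j =>
    intro p hp
    rw [pairings, Finset.mem_singleton] at hp
    rw [hp]
    exact isPairing_base hT
  | union T U ihT ihU =>
    obtain ⟨h1, h2, h3, -⟩ := hT
    intro p hp
    rcases Finset.mem_union.1 hp with hp | hp
    · exact ihT h1 p hp
    · rw [index, h3]; exact ihU h2 p hp
  | prod T U ihT ihU =>
    obtain ⟨h1, h2, h3⟩ := hT
    intro p hp
    obtain ⟨a, ha, b, hb, rfl⟩ := Finset.mem_image₂.1 hp
    exact (ihT h1 a ha).union (ihU h2 b hb) h3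

theorem pairings_nonempty (T : PairingTree n) : T.pairings.Nonempty := by
  induction T with
  | base i j => exact Finset.singleton_nonempty _
  | union T U ihT _ => exact ihT.mono Finset.subset_union_left
  | prod T U ihT ihU => exact ihT.image₂ ihU

theorem index_nonempty (T : PairingTree n) : T.index.Nonempty := by
  induction T with
  | base i j => exact ⟨i, Finset.mem_insert_self _ _⟩
  | union T U ihT _ => exact ihT
  | prod T U ihT _ => exact ihT.mono Finset.subset_union_left

end PairingTree

theorem PairingStructure.pairings_subset (T : PairingStructure n) :
    T.tree.pairings ⊆ allPairings Finset.univ := fun p hp =>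
  mem_allPairings.2 (T.index_eq ▸ PairingTree.isPairing_of_mem_pairings T.wellFormed p hp)

theorem PairingStructure.pos (T : PairingStructure n) : 0 < n := by
  obtain ⟨x, -⟩ := T.tree.index_nonempty
  exact x.pos

theorem PairingStructure.predictor_eq (T : PairingStructure n) :
    T.predictor = pairingComb fun p => if p ∈ T.tree.pairings then 1 else 0 :=
  funext fun w => pairingSum_eq_pairingComb T.pairings_subset w

end Structures

/-! ### Accuracy of approximate regression -/

section Accuracy

variable {n m : ℕ}

instance : IsProbabilityMeasure (gaussianWeights n) := by unfold gaussianWeights; infer_instance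

/-- The indicator of the set of pairings represented by `T`. -/
def pairingIndicator (T : PairingStructure n) (p : Finset (Sym2 (Fin n))) : ℝ :=
  if p ∈ T.tree.pairings then 1 else 0

/-- The number of common pairings of two pairing structures. -/
def overlap (T U : PairingStructure n) : ℝ := ((T.tree.pairings ∩ U.tree.pairings).card : ℝ)

theorem overlap_comm (T U : PairingStructure n) : overlap T U = overlap U T := by
  rw [overlap, overlap, Finset.inter_comm]

theorem sum_pairingIndicator_mul (T U : PairingStructure n) :
    ∑ p ∈ allPairings Finset.univ, pairingIndicator T p * pairingIndicator U p = overlap T U := by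
  simp only [pairingIndicator, ite_mul, one_mul, zero_mul, ← ite_and, ← Finset.mem_inter]
  rw [← Finset.sum_filter, Finset.filter_mem_eq_inter,
    Finset.inter_eq_right.2 (Finset.inter_subset_left.trans T.pairings_subset)]
  simp [overlap]

theorem sum_pairingIndicator (T : PairingStructure n) :
    ∑ p ∈ allPairings Finset.univ, pairingIndicator T p = overlap T T := by
  rw [← sum_pairingIndicator_mul]
  refine Finset.sum_congr rfl fun p _ => ?_
  unfold pairingIndicator; split_ifs <;> simp

theorem overlap_self_pos (T : PairingStructure n) : 0 < overlap T T := by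
  rw [overlap, Finset.inter_self]
  exact_mod_cast Finset.card_pos.2 T.tree.pairings_nonempty

theorem predictor_eq_pairingComb (T : PairingStructure n) :
    T.predictor = pairingComb (pairingIndicator T) := T.predictor_eq

theorem corrMatrix_predictor_apply (T : Fin m → PairingStructure n) (i j : Fin m) :
    corrMatrix (gaussianWeights n) (fun i => (T i).predictor) i j
      = overlap (T i) (T j) / (√(overlap (T i) (T i)) * √(overlap (T j) (T j))) := by
  have hcov : ∀ i j, cov[(T i).predictor, (T j).predictor; gaussianWeights n]
      = overlap (T i) (T j) := fun i j => by
    rw [predictor_eq_pairingComb, predictor_eq_pairingComb,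
      covariance_eq_sub (memLp_pairingComb _) (memLp_pairingComb _),
      integral_pairingComb (T i).pos, zero_mul, sub_zero, ← sum_pairingIndicator_mul]
    exact integral_pairingComb_mul _ _
  have hvar : ∀ i, Var[(T i).predictor; gaussianWeights n] = overlap (T i) (T i) := fun i => by
    rw [← hcov, covariance_self]
    rw [predictor_eq_pairingComb]
    exact (memLp_pairingComb _).aestronglyMeasurable.aemeasurable
  simp only [corrMatrix, hcov, hvar]
  rw [Real.sqrt_mul (overlap_self_pos _).le]

/-- It is the Gram matrix of the normalized indicator vectors of the represented sets. -/
theorem corrMatrix_predictor_posSemidef (T : Fin m → PairingStructure n) :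
    (corrMatrix (gaussianWeights n) fun i => (T i).predictor).PosSemidef := by
  have : corrMatrix (gaussianWeights n) (fun i => (T i).predictor)
      = (Matrix.of fun (i : Fin m) (p : {p // p ∈ allPairings (Finset.univ : Finset (Fin n))}) =>
          pairingIndicator (T i) p / √(overlap (T i) (T i)))
        * (Matrix.of fun (i : Fin m) (p : {p // p ∈ allPairings (Finset.univ : Finset (Fin n))}) =>
          pairingIndicator (T i) p / √(overlap (T i) (T i))).conjTranspose := by
    ext i j
    rw [corrMatrix_predictor_apply, Matrix.mul_apply, ← sum_pairingIndicator_mul,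
      Finset.sum_div, ← Finset.sum_attach]
    refine Finset.sum_congr rfl fun p _ => ?_
    simp only [Matrix.of_apply, Matrix.conjTranspose_apply, star_trivial]
    rw [div_mul_div_comm]
  rw [this]
  exact Matrix.posSemidef_self_mul_conjTranspose _

theorem dotProduct_predictor_eq_pairingComb (T : Fin m → PairingStructure n) (β : Fin m → ℝ) :
    (fun w => β ⬝ᵥ fun i => (T i).predictor w)
      = pairingComb fun p => ∑ i, β i * pairingIndicator (T i) p := by
  funext w
  simp only [dotProduct, predictor_eq_pairingComb, pairingComb, Finset.sum_mul, Finset.mul_sum]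
  rw [Finset.sum_comm]
  exact Finset.sum_congr rfl fun p _ => Finset.sum_congr rfl fun i _ => by ring

theorem pairingComb_sub (a b : Finset (Sym2 (Fin n)) → ℝ) (w : Edge n → ℝ) :
    pairingComb a w - pairingComb b w = pairingComb (a - b) w := by
  simp only [pairingComb, Pi.sub_apply, sub_mul, Finset.sum_sub_distrib]

theorem corrMatrix_predictor_self (T : Fin m → PairingStructure n) (i : Fin m) :
    corrMatrix (gaussianWeights n) (fun i => (T i).predictor) i i = 1 := by
  rw [corrMatrix_predictor_apply, Real.mul_self_sqrt (overlap_self_pos _).le]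
  exact div_self (overlap_self_pos _).ne'

theorem leastSingularValue_corrMatrix_le_one (hm : 0 < m) (T : Fin m → PairingStructure n) :
    leastSingularValue (corrMatrix (gaussianWeights n) fun i => (T i).predictor) ≤ 1 := by
  have h := leastSingularValue_mul_dotProduct_le hm (corrMatrix_predictor_posSemidef T)
    (Pi.single ⟨0, hm⟩ 1)
  simpa [corrMatrix_predictor_self] using h

/-- The regression coefficients computed from an approximation of the correlation matrix give an
accurate estimator. -/
theorem isApproxAccurate_of_sum_sq_le (hm : 0 < m) (T : Fin m → PairingStructure n)
    (K : Matrix (Fin m) (Fin m) ℝ) (hK : IsUnit K.det) {e ε σ : ℝ} (he0 : 0 ≤ e) (hε : 0 < ε)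
    (hσ : σ = leastSingularValue (corrMatrix (gaussianWeights n) fun i => (T i).predictor))
    (he : e ≤ ε * σ)
    (hKC : ∑ i, ∑ j, (K - corrMatrix (gaussianWeights n) fun i => (T i).predictor) i j ^ 2 ≤ e ^ 2)
    {d β : Fin m → ℝ} (hd : ∀ i, d i = √(overlap (T i) (T i)))
    (hβ : ∀ i, β i = (d i)⁻¹ * (K⁻¹.mulVec d) i) {f : (Edge n → ℝ) → ℝ}
    (hf : f = fun w => β ⬝ᵥ fun i => (T i).predictor w) :
    ∀ X ∈ ({fun _ => 1} ∪ Set.range (fun i => (T i).predictor) ∪ {f} : Set ((Edge n → ℝ) → ℝ)),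
      IsApproxAccurate (gaussianWeights n) target ε X f := by
  set C := corrMatrix (gaussianWeights n) fun i => (T i).predictor with hC
  set v := K⁻¹.mulVec d with hv
  have hd0 : ∀ i, 0 < d i := fun i => by rw [hd]; exact Real.sqrt_pos.2 (overlap_self_pos _)
  have hdd : ∀ i, d i ^ 2 = overlap (T i) (T i) := fun i => by
    rw [hd, Real.sq_sqrt (overlap_self_pos _).le]
  have hov : ∀ i j, overlap (T i) (T j) = d i * C i j * d j := fun i j => by
    rw [hC, corrMatrix_predictor_apply, ← hd, ← hd]
    have := (hd0 i).ne'; have := (hd0 j).ne'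
    field_simp
  have hβd : ∀ i, d i * β i = v i := fun i => by
    rw [hβ, mul_inv_cancel_left₀ (hd0 i).ne']
  have hKv : K.mulVec v = d := by
    rw [hv, Matrix.mulVec_mulVec, Matrix.mul_nonsing_inv _ hK, Matrix.one_mulVec]
  set u := (K - C).mulVec v with hu
  -- Since K v = d exactly, `u` is the residual of `v` in the true normal equations C v = d.
  have huv : ∀ i, u i = d i - (C.mulVec v) i := fun i => by
    rw [hu, Matrix.sub_mulVec, hKv]; rfl
  set b : Finset (Sym2 (Fin n)) → ℝ := fun p => ∑ i, β i * pairingIndicator (T i) p with hb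
  have hfc : f = pairingComb b := by rw [hf, dotProduct_predictor_eq_pairingComb]
  -- Here E[Y X_i] = d_i² and E[f X_i] = d_i (C v)_i.
  have hXu : ∀ i, ∫ w, (target w - f w) * (T i).predictor w ∂gaussianWeights n = d i * u i := by
    intro i
    simp only [target_eq_pairingComb, hfc, predictor_eq_pairingComb, pairingComb_sub,
      integral_pairingComb_mul]
    simp only [Pi.sub_apply, sub_mul, one_mul, Finset.sum_sub_distrib, sum_pairingIndicator, hb,
      Finset.sum_mul]
    rw [Finset.sum_comm]
    simp only [mul_assoc, ← Finset.mul_sum, sum_pairingIndicator_mul]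
    rw [huv, ← hdd, mul_sub, sq, Matrix.mulVec, dotProduct, Finset.mul_sum]
    congr 1
    refine Finset.sum_congr rfl fun j _ => ?_
    rw [hov, ← hβd]
    have hs : C j i = C i j := by
      rw [hC, corrMatrix_predictor_apply, corrMatrix_predictor_apply,
        overlap_comm (T j) (T i), mul_comm]
    rw [hs]
    ring
  have hfX : ∀ w, f w = ∑ i, β i * (T i).predictor w := fun w => by rw [hf]; rfl
  have hff : ∫ w, (target w - f w) * f w ∂gaussianWeights n = v ⬝ᵥ u := by
    have e1 : ∀ w, (target w - f w) * f w
        = ∑ i, β i * ((target w - f w) * (T i).predictor w) := fun w => by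
      conv_lhs => rw [hfX w]
      rw [Finset.mul_sum, ← hfX w]
      exact Finset.sum_congr rfl fun i _ => by ring
    simp only [e1]
    rw [integral_finsetSum]
    · simp only [integral_const_mul, hXu, dotProduct]
      exact Finset.sum_congr rfl fun i _ => by rw [← hβd]; ring
    · intro i _
      refine Integrable.const_mul ?_ _
      simp only [target_eq_pairingComb, hfc, predictor_eq_pairingComb, pairingComb_sub]
      exact (memLp_pairingComb _).integrable_mul (memLp_pairingComb _)
  have hf2 : ∫ w, f w ^ 2 ∂gaussianWeights n = v ⬝ᵥ C.mulVec v := by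
    simp only [hfc, sq, integral_pairingComb_mul]
    simp only [hb, Finset.sum_mul_sum]
    rw [Finset.sum_comm]
    simp only [dotProduct, Matrix.mulVec, Finset.mul_sum]
    refine Finset.sum_congr rfl fun i _ => ?_
    rw [Finset.sum_comm]
    refine Finset.sum_congr rfl fun j _ => ?_
    have : ∀ p, β i * pairingIndicator (T i) p * (β j * pairingIndicator (T j) p)
        = β i * β j * (pairingIndicator (T i) p * pairingIndicator (T j) p) := fun p => by ring
    simp only [this, ← Finset.mul_sum, sum_pairingIndicator_mul]
    rw [hov, ← hβd, ← hβd]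
    ring
  have hX2 : ∀ i, ∫ w, (T i).predictor w ^ 2 ∂gaussianWeights n = d i ^ 2 := fun i => by
    simp only [predictor_eq_pairingComb, sq, integral_pairingComb_mul, sum_pairingIndicator_mul]
    rw [← hdd, sq]
  have hCv : σ * (v ⬝ᵥ v) ≤ v ⬝ᵥ C.mulVec v := by
    rw [hσ]
    exact leastSingularValue_mul_dotProduct_le hm (corrMatrix_predictor_posSemidef T) v
  have hσ1 : σ ≤ 1 := by rw [hσ]; exact leastSingularValue_corrMatrix_le_one hm T
  have hσ0 : 0 ≤ σ := by rw [hσ]; exact leastSingularValue_nonneg _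
  have hun : ‖WithLp.toLp 2 u‖ ≤ e * ‖WithLp.toLp 2 v‖ := norm_mulVec_le_of_sum_sq_le _ he0 hKC v
  have huu : u ⬝ᵥ u ≤ (ε * σ) ^ 2 * (v ⬝ᵥ v) := by
    rw [← norm_toLp_sq, ← norm_toLp_sq, ← mul_pow]
    refine pow_le_pow_left₀ (norm_nonneg _) (hun.trans ?_) 2
    gcongr
  have hvv : 0 ≤ v ⬝ᵥ v := by rw [← norm_toLp_sq]; positivity
  have hmem : MemLp (target : (Edge n → ℝ) → ℝ) 2 (gaussianWeights n) := by
    rw [target_eq_pairingComb]; exact memLp_pairingComb _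
  have hmemf : MemLp f 2 (gaussianWeights n) := by rw [hfc]; exact memLp_pairingComb _
  rintro X ((hX | ⟨i, rfl⟩) | hX)
  · rw [Set.mem_singleton_iff] at hX
    subst hX
    refine ⟨hmem, memLp_const 1, hmemf, ?_⟩
    have : ∫ w, (target w - f w) * (1 : ℝ) ∂gaussianWeights n = 0 := by
      simp only [target_eq_pairingComb, hfc, pairingComb_sub, mul_one]
      exact integral_pairingComb (T ⟨0, hm⟩).pos _
    rw [this]
    have h1 : 0 ≤ ∫ w, f w ^ 2 ∂gaussianWeights n := integral_nonneg fun w => sq_nonneg _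
    simp only [one_pow, integral_const, probReal_univ, smul_eq_mul, mul_one]
    nlinarith [mul_nonneg (sq_nonneg ε) h1]
  · refine ⟨hmem, ?_, hmemf, ?_⟩
    · simp only [predictor_eq_pairingComb]; exact memLp_pairingComb _
    · simp only [hXu, hX2, hf2]
      have h1 : u i ^ 2 ≤ u ⬝ᵥ u := by
        simp only [dotProduct, ← sq]
        exact Finset.single_le_sum (f := fun i => u i ^ 2) (fun j _ => sq_nonneg _)
          (Finset.mem_univ i)
      -- One factor σ is spent on σ|v|² ≤ E[f²]; the other is dropped because σ ≤ 1.
      have h2 : u i ^ 2 ≤ ε ^ 2 * (v ⬝ᵥ C.mulVec v) := by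
        refine h1.trans (huu.trans ?_)
        rw [mul_pow, mul_assoc]
        refine mul_le_mul_of_nonneg_left (le_trans ?_ hCv) (sq_nonneg _)
        rw [sq, mul_assoc]
        exact mul_le_of_le_one_left (mul_nonneg hσ0 hvv) hσ1
      calc (d i * u i) ^ 2 = d i ^ 2 * u i ^ 2 := by ring
        _ ≤ d i ^ 2 * (ε ^ 2 * (v ⬝ᵥ C.mulVec v)) := by gcongr
        _ = _ := by ring
  · rw [Set.mem_singleton_iff] at hX
    subst hX
    refine ⟨hmem, hmemf, hmemf, ?_⟩
    rw [hff, hf2]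
    have h1 : (v ⬝ᵥ u) ^ 2 ≤ (v ⬝ᵥ v) * (u ⬝ᵥ u) := by
      have := Finset.sum_mul_sq_le_sq_mul_sq Finset.univ v u
      simpa [dotProduct, sq] using this
    -- For X = f both factors σ are spent, each on one factor E[f²] of the right-hand side.
    calc (v ⬝ᵥ u) ^ 2 ≤ (v ⬝ᵥ v) * ((ε * σ) ^ 2 * (v ⬝ᵥ v)) :=
          h1.trans (mul_le_mul_of_nonneg_left huu hvv)
      _ = ε ^ 2 * ((σ * (v ⬝ᵥ v)) * (σ * (v ⬝ᵥ v))) := by ring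
      _ ≤ ε ^ 2 * ((v ⬝ᵥ C.mulVec v) * (v ⬝ᵥ C.mulVec v)) := by
          gcongr
          exact (mul_nonneg hσ0 hvv).trans hCv
      _ = _ := by ring

end Accuracy

/-! ### Correctness and cost of the recursive procedures -/

section Procedures

namespace Timed

variable {α β : Type}

@[simp] theorem bind_val (x : Timed α) (f : α → Timed β) : (x >>= f).val = (f x.val).val := rfl

@[simp] theorem bind_steps (x : Timed α) (f : α → Timed β) :
    (x >>= f).steps = x.steps + (f x.val).steps := rfl

@[simp] theorem pure_val (a : α) : (pure a : Timed α).val = a := rfl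

@[simp] theorem pure_steps (a : α) : (pure a : Timed α).steps = 0 := rfl

@[simp] theorem tick_steps (k : ℕ) : (tick k).steps = k := rfl

end Timed

variable {n : ℕ}

/-- The set of pairs in a list. -/
def edges (p : PairList n) : Finset (Sym2 (Fin n)) := (p.map fun e => s(e.1, e.2)).toFinset

theorem mem_edges {p : PairList n} {e : Sym2 (Fin n)} :
    e ∈ edges p ↔ ∃ x ∈ p, s(x.1, x.2) = e := by simp [edges]

theorem edges_append (p q : PairList n) : edges (p ++ q) = edges p ∪ edges q := by
  simp [edges]

/-- A pair of `q` has a point, the pair of `p` covering it also lies in `q`, and uniqueness in `q`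
identifies the two. -/
theorem IsPairing.eq_of_subset {K : Finset (Fin n)} {p q : Finset (Sym2 (Fin n))}
    (hp : IsPairing K p) (hq : IsPairing K q) (h : p ⊆ q) : p = q := by
  refine h.antisymm fun e he => ?_
  obtain ⟨x, hx⟩ : ∃ x, x ∈ e := ⟨e.out.1, Sym2.out_fst_mem e⟩
  obtain ⟨e', ⟨h1, h2⟩, -⟩ := hp.2 x ((hq.1 e he).2 x hx)
  have := (hq.2 x ((hq.1 e he).2 x hx)).unique ⟨he, hx⟩ ⟨h h1, h2⟩
  rwa [this]

/-- Every pair of a pairing has a point. -/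
theorem IsPairing.exists_mem {K : Finset (Fin n)} {p : Finset (Sym2 (Fin n))}
    (hp : IsPairing K p) {e : Sym2 (Fin n)} (he : e ∈ p) : ∃ x ∈ e, x ∈ K :=
  ⟨e.out.1, Sym2.out_fst_mem e, (hp.1 e he).2 _ (Sym2.out_fst_mem e)⟩

/-- The two parts of a union are told apart by the index set that contains their points. This makes
products of structures multiplicative in counting and sampling. -/
theorem union_inj_of_isPairing {K L : Finset (Fin n)} (h : Disjoint K L)
    {p p' q q' : Finset (Sym2 (Fin n))} (hp : IsPairing K p) (hp' : IsPairing K p')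
    (hq : IsPairing L q) (hq' : IsPairing L q') (e : p ∪ q = p' ∪ q') : p = p' ∧ q = q' := by
  constructor
  · refine hp.eq_of_subset hp' fun x hx => ?_
    rcases Finset.mem_union.1 (e ▸ Finset.mem_union_left q hx) with h' | h'
    · exact h'
    · obtain ⟨y, hy, hyK⟩ := hp.exists_mem hx
      exact absurd ((hq'.1 x h').2 y hy) (Finset.disjoint_left.1 h hyK)
  · refine hq.eq_of_subset hq' fun x hx => ?_
    rcases Finset.mem_union.1 (e ▸ Finset.mem_union_right p hx) with h' | h'
    · obtain ⟨y, hy, hyL⟩ := hq.exists_mem hx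
      exact absurd hyL (Finset.disjoint_left.1 h ((hp'.1 x h').2 y hy))
    · exact h'

theorem numPairings_val {T : PairingTree n} (hT : T.WellFormed) :
    (numPairings T).val = T.pairings.card := by
  induction T with
  | base i j => simp [numPairings, PairingTree.pairings]
  | union T U ihT ihU =>
    obtain ⟨h1, h2, -, h4⟩ := hT
    simp [numPairings, PairingTree.pairings, ihT h1, ihU h2, Finset.card_union_of_disjoint h4]
  | prod T U ihT ihU =>
    obtain ⟨h1, h2, h3⟩ := hT
    simp only [numPairings, PairingTree.pairings, Timed.bind_val, Timed.pure_val, ihT h1, ihU h2]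
    symm
    rw [Finset.card_image₂_iff]
    rintro ⟨a, b⟩ hab ⟨a', b'⟩ hab' e
    simp only [Set.mem_prod, Finset.mem_coe] at hab hab'
    obtain ⟨rfl, rfl⟩ := union_inj_of_isPairing h3
      (PairingTree.isPairing_of_mem_pairings h1 a hab.1)
      (PairingTree.isPairing_of_mem_pairings h1 a' hab'.1)
      (PairingTree.isPairing_of_mem_pairings h2 b hab.2)
      (PairingTree.isPairing_of_mem_pairings h2 b' hab'.2) e
    rfl

theorem numPairings_steps_le (T : PairingTree n) : (numPairings T).steps ≤ 2 * T.rsize := by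
  induction T with
  | base i j => simp [numPairings, PairingTree.rsize]
  | union T U ihT ihU =>
    simp only [numPairings, PairingTree.rsize, Timed.bind_steps, Timed.tick_steps,
      Timed.pure_steps]
    omega
  | prod T U ihT ihU =>
    simp only [numPairings, PairingTree.rsize, Timed.bind_steps, Timed.tick_steps,
      Timed.pure_steps]
    omega

theorem card_index_le (T : PairingTree n) : T.index.card ≤ 2 * T.rsize := by
  induction T with
  | base i j => exact Finset.card_le_two
  | union T U ihT _ => simp only [PairingTree.index, PairingTree.rsize]; omega
  | prod T U ihT ihU =>
    simp only [PairingTree.index, PairingTree.rsize]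
    have := Finset.card_union_le T.index U.index
    omega

theorem one_le_rsize (T : PairingTree n) : 1 ≤ T.rsize := by
  cases T <;> simp [PairingTree.rsize]

theorem split_val (K : Finset (Fin n)) (p : PairList n) :
    (split K p).val = if ∀ e ∈ p, (e.1 ∈ K ↔ e.2 ∈ K) then some (p.filter fun e => e.1 ∈ K)
      else none := by
  induction p with
  | nil => simp [split]
  | cons e p ih =>
    obtain ⟨i, j⟩ := e
    simp only [split, memTest, Timed.bind_val]
    by_cases hi : i ∈ K <;> by_cases hj : j ∈ K <;> simp [hi, hj, ih]

theorem split_steps_le (K : Finset (Fin n)) (p : PairList n) :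
    (split K p).steps ≤ 1 + p.length * (2 * K.card + 4) := by
  induction p with
  | nil => simp [split]
  | cons e p ih =>
    obtain ⟨i, j⟩ := e
    simp only [split, memTest, Timed.bind_steps, Timed.tick_steps, List.length_cons, add_mul,
      one_mul]
    split_ifs <;> simp only [Timed.bind_steps, Timed.pure_steps] <;> omega

theorem contains_prod_val (T U : PairingTree n) (p : PairList n) :
    (contains (.prod T U) p).val = true ↔ (∀ e ∈ p, (e.1 ∈ T.index ↔ e.2 ∈ T.index)) ∧
      (contains T (p.filter fun e => e.1 ∈ T.index)).val = true ∧
      (contains U (p.filter fun e => e.1 ∉ T.index)).val = true := by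
  simp only [contains, Timed.bind_val, split_val]
  split_ifs with h
  · have hd : (listDiff p (p.filter fun e => e.1 ∈ T.index)).val
        = p.filter fun e => e.1 ∉ T.index := by
      refine List.filter_congr fun e he => ?_
      simp [he]
    by_cases hc : (contains T (p.filter fun e => e.1 ∈ T.index)).val = true
    · simp only [hc, if_true, Timed.bind_val, hd]; tauto
    · rw [Timed.bind_val, if_neg hc, Timed.pure_val]
      exact ⟨fun h' => absurd h' Bool.false_ne_true, fun h' => absurd h'.2.1 hc⟩
  · exact ⟨fun h' => h'.elim, fun h' => absurd h'.1 h⟩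

/-- Each node is visited at most once, and restriction only shortens lists. The budget per node
covers `split`, with index sets of size at most 2R, and `listDiff`. -/
theorem contains_steps_le (T : PairingTree n) {R l : ℕ} (hR : T.rsize ≤ R) (p : PairList n)
    (hp : p.length ≤ l) :
    (contains T p).steps ≤ T.rsize * (3 + l * (4 * R + 4) + l * (2 * l + 2)) := by
  induction T generalizing p with
  | base i j => 
    simp only [contains, PairingTree.rsize, Timed.bind_steps, Timed.tick_steps, Timed.pure_steps]
    omega
  | union T U ihT ihU =>
    simp only [PairingTree.rsize] at hR
    have h1 := ihT (by omega) p hp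
    have h2 := ihU (by omega) p hp
    simp only [contains, PairingTree.rsize, Timed.bind_steps, Timed.tick_steps]
    simp only [add_mul _ _ (3 + l * (4 * R + 4) + l * (2 * l + 2)), one_mul]
    split_ifs
    · simp only [Timed.pure_steps]; omega
    · omega
  | prod T U ihT ihU =>
    simp only [PairingTree.rsize] at hR
    have hs := split_steps_le T.index p
    have hs2 : p.length * (2 * T.index.card + 4) ≤ l * (4 * R + 4) := by
      have := card_index_le T
      exact Nat.mul_le_mul hp (by omega)
    simp only [contains, PairingTree.rsize, Timed.bind_steps, Timed.tick_steps]
    rw [split_val]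
    simp only [add_mul _ _ (3 + l * (4 * R + 4) + l * (2 * l + 2)), one_mul]
    split_ifs with h
    · have hlen : (p.filter fun e => decide (e.1 ∈ T.index)).length ≤ l :=
        (List.length_filter_le _ _).trans hp
      have h1 := ihT (by omega) _ hlen
      simp only [Timed.bind_steps]
      split_ifs with hc
      · have hlen2 : (listDiff p (p.filter fun e => decide (e.1 ∈ T.index))).val.length ≤ l :=
          (List.length_filter_le _ _).trans hp
        have h2 := ihU (by omega) _ hlen2
        have h3 : (listDiff p (p.filter fun e => decide (e.1 ∈ T.index))).steps
            ≤ l * (2 * l + 2) + 1 := by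
          simp only [listDiff]
          gcongr
        simp only [Timed.bind_steps]
        omega
      · simp only [Timed.pure_steps]
        omega
    · simp only [Timed.pure_steps]
      omega

/-- No pair crosses the boundary of `K`, so the pair covering a point of `M` survives the filter.
Keeping `K` and `M` separate allows the right factor of a product to be treated with `K` the
complement of the left index set. -/
theorem isPairing_edges_filter {K L M : Finset (Fin n)} {p : PairList n}
    (hp : IsPairing L (edges p)) (hM : M ⊆ L) (hKM : ∀ x ∈ L, x ∈ M ↔ x ∈ K)
    (h : ∀ e ∈ p, (e.1 ∈ K ↔ e.2 ∈ K)) : IsPairing M (edges (p.filter fun e => e.1 ∈ K)) := by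
  have hsub : ∀ e ∈ edges (p.filter fun e => e.1 ∈ K), e ∈ edges p := by
    intro e he
    obtain ⟨x, hx, rfl⟩ := mem_edges.1 he
    exact mem_edges.2 ⟨x, (List.mem_filter.1 hx).1, rfl⟩
  refine ⟨fun e he => ⟨(hp.1 e (hsub e he)).1, fun x hx => ?_⟩, fun x hx => ?_⟩
  · have hxL := (hp.1 e (hsub e he)).2 x hx
    rw [hKM x hxL]
    obtain ⟨y, hy, rfl⟩ := mem_edges.1 he
    obtain ⟨hy1, hy2⟩ := List.mem_filter.1 hy
    simp only [decide_eq_true_eq] at hy2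
    rcases Sym2.mem_iff.1 hx with rfl | rfl
    · exact hy2
    · exact (h y hy1).1 hy2
  · obtain ⟨e, ⟨he, hxe⟩, hu⟩ := hp.2 x (hM hx)
    refine ⟨e, ⟨?_, hxe⟩, fun e' he' => hu e' ⟨hsub _ he'.1, he'.2⟩⟩
    obtain ⟨y, hy, rfl⟩ := mem_edges.1 he
    refine mem_edges.2 ⟨y, List.mem_filter.2 ⟨hy, ?_⟩, rfl⟩
    have hxK : x ∈ K := (hKM x (hM hx)).1 hx
    simp only [decide_eq_true_eq]
    rcases Sym2.mem_iff.1 hxe with rfl | rfl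
    · exact hxK
    · exact (h y hy).2 hxK

theorem contains_val_iff {T : PairingTree n} (hT : T.WellFormed) (p : PairList n)
    (hp : IsPairing T.index (edges p)) :
    (contains T p).val = true ↔ edges p ∈ T.pairings := by
  induction T generalizing p with
  | base i j =>
    -- A two-point set has only one pairing, which is why the test may return true without
    -- inspecting `p`.
    have : edges p = {s(i, j)} := by
      refine (IsPairing.eq_of_subset (isPairing_base hT) hp ?_).symm
      rw [Finset.singleton_subset_iff]
      obtain ⟨e, ⟨he, hie⟩, -⟩ := hp.2 i (Finset.mem_insert_self _ _)
      obtain ⟨e', ⟨he', hje⟩, -⟩ := hp.2 j (by simp [PairingTree.index])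
      have h1 := hp.1 e he
      obtain ⟨k, rfl⟩ := Sym2.mem_iff_exists.1 hie
      have hk := h1.2 k (Sym2.mem_mk_right i k)
      simp only [PairingTree.index, Finset.mem_insert, Finset.mem_singleton] at hk
      rcases hk with rfl | rfl
      · simp at h1
      · exact he
    simp [contains, PairingTree.pairings, this]
  | union T U ihT ihU =>
    obtain ⟨h1, h2, h3, -⟩ := hT
    have e1 := ihT h1 p hp
    have e2 := ihU h2 p (h3 ▸ hp)
    simp only [PairingTree.pairings, Finset.mem_union, ← e1, ← e2, contains, Timed.bind_val]
    split_ifs with h <;> simp [h]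
  | prod T U ihT ihU =>
    obtain ⟨h1, h2, h3⟩ := hT
    rw [contains_prod_val]
    simp only [PairingTree.index] at hp
    have hedge : edges p = edges (p.filter fun e => e.1 ∈ T.index)
        ∪ edges (p.filter fun e => e.1 ∉ T.index) := by
      ext e
      simp only [Finset.mem_union, mem_edges, List.mem_filter, decide_eq_true_eq]
      constructor
      · rintro ⟨x, hx, rfl⟩
        by_cases hxT : x.1 ∈ T.index
        · exact Or.inl ⟨x, ⟨hx, hxT⟩, rfl⟩
        · exact Or.inr ⟨x, ⟨hx, hxT⟩, rfl⟩
      · rintro (⟨x, hx, rfl⟩ | ⟨x, hx, rfl⟩) <;> exact ⟨x, hx.1, rfl⟩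
    have hfil : (∀ e ∈ p, (e.1 ∈ T.index ↔ e.2 ∈ T.index)) →
        IsPairing T.index (edges (p.filter fun e => e.1 ∈ T.index)) ∧
        IsPairing U.index (edges (p.filter fun e => e.1 ∉ T.index)) := by
      intro h
      refine ⟨isPairing_edges_filter hp Finset.subset_union_left (fun x _ => Iff.rfl) h, ?_⟩
      have := isPairing_edges_filter (K := T.indexᶜ) (M := U.index) hp Finset.subset_union_right
        (fun x hx => ?_) (fun e he => by simpa using not_congr (h e he))
      · simpa using this
      · rw [Finset.mem_compl]
        refine ⟨fun hU hT => Finset.disjoint_left.1 h3 hT hU, fun hT => ?_⟩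
        exact (Finset.mem_union.1 hx).resolve_left hT
    constructor
    · rintro ⟨h, hc1, hc2⟩
      obtain ⟨hp1, hp2⟩ := hfil h
      rw [ihT h1 _ hp1] at hc1
      rw [ihU h2 _ hp2] at hc2
      rw [PairingTree.pairings, hedge]
      exact Finset.mem_image₂_of_mem hc1 hc2
    · intro h
      obtain ⟨a, ha, b, hb, hab⟩ := Finset.mem_image₂.1 h
      have hpa := PairingTree.isPairing_of_mem_pairings h1 a ha
      have hpb := PairingTree.isPairing_of_mem_pairings h2 b hb
      -- A pairing coming from the product has no pair with exactly one point in the left index set.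
      have hcross : ∀ e ∈ p, (e.1 ∈ T.index ↔ e.2 ∈ T.index) := by
        intro e he
        have hm : s(e.1, e.2) ∈ a ∪ b := hab ▸ mem_edges.2 ⟨e, he, rfl⟩
        rcases Finset.mem_union.1 hm with hm | hm
        · have := (hpa.1 _ hm).2
          exact iff_of_true (this _ (Sym2.mem_mk_left _ _)) (this _ (Sym2.mem_mk_right _ _))
        · have := (hpb.1 _ hm).2
          exact iff_of_false
            (fun hT => Finset.disjoint_left.1 h3 hT (this _ (Sym2.mem_mk_left _ _)))
            (fun hT => Finset.disjoint_left.1 h3 hT (this _ (Sym2.mem_mk_right _ _)))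
      obtain ⟨hp1, hp2⟩ := hfil hcross
      obtain ⟨rfl, rfl⟩ := union_inj_of_isPairing h3 hpa hp1 hpb hp2 (hab.trans hedge)
      exact ⟨hcross, (ihT h1 _ hp1).2 ha, (ihU h2 _ hp2).2 hb⟩

end Procedures

/-! ### The law of the sampling procedure -/

section Sampling

namespace Rand

variable {α β : Type}

/-- The law of the result of a randomized computation. -/
noncomputable def vals (x : Rand α) : PMF α := x.law.map Timed.val

theorem bind_law (x : Rand α) (f : α → Rand β) : (x >>= f).law
    = x.law.bind fun a => (f a.val).law.map fun b => ⟨b.val, a.steps + b.steps⟩ := rfl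

theorem pure_law (a : α) : (pure a : Rand α).law = PMF.pure ⟨a, 0⟩ := rfl

theorem vals_bind (x : Rand α) (f : α → Rand β) :
    (x >>= f).vals = x.vals.bind fun a => (f a).vals := by
  simp only [vals, bind_law, PMF.map_bind, PMF.map_comp, PMF.bind_map]
  rfl

theorem vals_pure (a : α) : (pure a : Rand α).vals = PMF.pure a := by
  simp [vals, pure_law, PMF.pure_map]

theorem vals_toRand (x : Timed α) : x.toRand.vals = PMF.pure x.val := by
  simp [vals, Timed.toRand, PMF.pure_map]

theorem mem_support_bind {x : Rand α} {f : α → Rand β} {t : Timed β} :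
    t ∈ (x >>= f).law.support ↔
      ∃ a ∈ x.law.support, ∃ b ∈ (f a.val).law.support, t = ⟨b.val, a.steps + b.steps⟩ := by
  simp [bind_law, PMF.support_map, eq_comm]

theorem mem_support_pure {a : α} {t : Timed α} :
    t ∈ (pure a : Rand α).law.support ↔ t = ⟨a, 0⟩ := by
  simp [pure_law]

theorem mem_support_toRand {x t : Timed α} : t ∈ x.toRand.law.support ↔ t = x := by
  simp [Timed.toRand]

end Rand

theorem uniformLt_vals_true {q : ℝ} (h1 : q ≤ 1) :
    (uniformLt q).vals true = ENNReal.ofReal q := by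
  have e : (uniformLt q).vals = (uniform01.map fun r => decide (r < q)).toPMF := by
    rw [Rand.vals, uniformLt, PMF.map_comp]
    exact PMF.map_id _
  rw [e, Measure.toPMF_apply, Measure.map_apply (by exact measurable_decide_lt q) (by simp),
    uniform01, Measure.restrict_apply (measurable_decide_lt q (by simp))]
  have : (fun r : ℝ => decide (r < q)) ⁻¹' {true} ∩ Set.Ico 0 1 = Set.Ico 0 q := by
    ext r
    simp only [Set.mem_inter_iff, Set.mem_preimage, Set.mem_singleton_iff, decide_eq_true_eq,
      Set.mem_Ico]
    constructor
    · rintro ⟨h, h', -⟩; exact ⟨h', h⟩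
    · rintro ⟨h, h'⟩; exact ⟨h', h, h'.trans_le h1⟩
  rw [this, Real.volume_Ico, sub_zero]

theorem uniformLt_vals_false {q : ℝ} (h0 : 0 ≤ q) (h1 : q ≤ 1) :
    (uniformLt q).vals false = ENNReal.ofReal (1 - q) := by
  have h := (uniformLt q).vals.tsum_coe
  rw [tsum_bool, uniformLt_vals_true h1] at h
  rw [ENNReal.ofReal_sub _ h0, ENNReal.ofReal_one]
  exact ENNReal.eq_sub_of_add_eq ENNReal.ofReal_ne_top h

variable {n : ℕ}

theorem uniformLt_law_steps {q : ℝ} {t : Timed Bool} (ht : t ∈ (uniformLt q).law.support) :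
    t.steps = 2 := by
  simp only [uniformLt, PMF.support_map, Set.mem_image] at ht
  obtain ⟨b, -, rfl⟩ := ht
  rfl

/-- A call of `sample` returns a list of the pairs of a represented pairing, and takes
quadratically many steps. -/
theorem sample_support (T : PairingTree n) {R : ℕ} (hR : T.rsize ≤ R) :
    ∀ t ∈ (sample T).law.support, edges t.val ∈ T.pairings ∧ t.val.length ≤ T.rsize ∧
      t.steps ≤ T.rsize * (4 * R + 4) := by
  induction T with
  | base i j =>
    intro t ht
    simp only [sample, Rand.mem_support_bind, Rand.mem_support_toRand, Rand.mem_support_pure] at ht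
    obtain ⟨_, rfl, _, rfl, rfl⟩ := ht
    refine ⟨?_, ?_, ?_⟩
    · simp [edges, PairingTree.pairings]
    · simp [PairingTree.rsize]
    · simp only [Timed.tick_steps, PairingTree.rsize]; omega
  | prod T U ihT ihU =>
    simp only [PairingTree.rsize] at hR ⊢
    intro t ht
    simp only [sample, Rand.mem_support_bind, Rand.mem_support_toRand, Rand.mem_support_pure] at ht
    obtain ⟨a, ha, _, ⟨b, hb, _, ⟨_, rfl, _, rfl, rfl⟩, rfl⟩, rfl⟩ := ht
    obtain ⟨ha1, ha2, ha3⟩ := ihT (by omega) a ha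
    obtain ⟨hb1, hb2, hb3⟩ := ihU (by omega) b hb
    refine ⟨?_, ?_, ?_⟩
    · rw [PairingTree.pairings, edges_append]
      exact Finset.mem_image₂_of_mem ha1 hb1
    · simp only [List.length_append]; omega
    · simp only [Timed.tick_steps, add_mul _ _ (4 * R + 4), one_mul]; omega
  | union T U ihT ihU =>
    have hn1 := numPairings_steps_le T
    have hn2 := numPairings_steps_le (T.union U)
    simp only [PairingTree.rsize] at hR hn2 ⊢
    intro t ht
    simp only [sample, Rand.mem_support_bind, Rand.mem_support_toRand] at ht
    obtain ⟨_, rfl, _, ⟨_, rfl, _, ⟨_, rfl, _, ⟨c, hc, b, hb, rfl⟩, rfl⟩, rfl⟩, rfl⟩ := ht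
    have hc2 := uniformLt_law_steps hc
    simp only [Timed.tick_steps, add_mul _ _ (4 * R + 4), one_mul, hc2, PairingTree.pairings,
      Finset.mem_union]
    split_ifs at hb
    · obtain ⟨h1, h2, h3⟩ := ihT (by omega) b hb
      exact ⟨Or.inl h1, by omega, by omega⟩
    · obtain ⟨h1, h2, h3⟩ := ihU (by omega) b hb
      exact ⟨Or.inr h1, by omega, by omega⟩

/-- Under injectivity the union map carries the uniform law on pairs to the uniform law on its
image. -/
theorem uniformOfFinset_bind_map_union {S U : Finset (Finset (Sym2 (Fin n)))} (hS : S.Nonempty)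
    (hU : U.Nonempty) (hinj : ∀ a ∈ S, ∀ b ∈ U, ∀ a' ∈ S, ∀ b' ∈ U, a ∪ b = a' ∪ b' →
      a = a' ∧ b = b') (hSU : (Finset.image₂ (· ∪ ·) S U).Nonempty) :
    ((PMF.uniformOfFinset S hS).bind fun a => (PMF.uniformOfFinset U hU).map (a ∪ ·))
      = PMF.uniformOfFinset (Finset.image₂ (· ∪ ·) S U) hSU := by
  ext P
  rw [PMF.bind_apply]
  by_cases hP : P ∈ Finset.image₂ (· ∪ ·) S U
  · rw [PMF.uniformOfFinset_apply_of_mem _ hP]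
    obtain ⟨a, ha, b, hb, rfl⟩ := Finset.mem_image₂.1 hP
    have hcard : (Finset.image₂ (· ∪ ·) S U).card = S.card * U.card := by
      rw [Finset.card_image₂_iff]
      rintro ⟨a, b⟩ hab ⟨a', b'⟩ hab' e
      obtain ⟨rfl, rfl⟩ := hinj a hab.1 b hab.2 a' hab'.1 b' hab'.2 e
      rfl
    rw [tsum_eq_single a, PMF.map_apply, tsum_eq_single b, if_pos rfl,
      PMF.uniformOfFinset_apply_of_mem _ ha, PMF.uniformOfFinset_apply_of_mem _ hb, hcard,
      Nat.cast_mul, ENNReal.mul_inv (by simp) (by simp)]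
    · intro b' hb'
      split_ifs with h
      · by_cases hbU : b' ∈ U
        · exact absurd (hinj a ha b hb a ha b' hbU h).2.symm hb'
        · exact PMF.uniformOfFinset_apply_of_notMem _ hbU
      · rfl
    · intro a' ha'
      by_cases haS : a' ∈ S
      · rw [PMF.map_apply, ENNReal.tsum_eq_zero.2, mul_zero]
        intro b'
        split_ifs with h
        · by_cases hbU : b' ∈ U
          · exact absurd (hinj a ha b hb a' haS b' hbU h).1.symm ha'
          · exact PMF.uniformOfFinset_apply_of_notMem _ hbU
        · rfl
      · rw [PMF.uniformOfFinset_apply_of_notMem _ haS, zero_mul]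
  · rw [PMF.uniformOfFinset_apply_of_notMem _ hP, ENNReal.tsum_eq_zero]
    intro a
    by_cases ha : a ∈ S
    · rw [PMF.map_apply, ENNReal.tsum_eq_zero.2, mul_zero]
      intro b
      split_ifs with h
      · by_cases hb : b ∈ U
        · exact absurd (h ▸ Finset.mem_image₂_of_mem ha hb) hP
        · exact PMF.uniformOfFinset_apply_of_notMem _ hb
      · rfl
    · rw [PMF.uniformOfFinset_apply_of_notMem _ ha, zero_mul]

/-- The sampling procedure is uniform on the represented pairings. -/
theorem sample_vals_map_edges {T : PairingTree n} (hT : T.WellFormed) :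
    (sample T).vals.map edges = PMF.uniformOfFinset T.pairings T.pairings_nonempty := by
  induction T with
  | base i j =>
    simp only [sample, Rand.vals_bind, Rand.vals_toRand, Rand.vals_pure, PMF.pure_bind,
      PMF.pure_map]
    ext P
    simp [edges, PairingTree.pairings, PMF.uniformOfFinset_apply, PMF.pure_apply]
  | prod T U ihT ihU =>
    obtain ⟨h1, h2, h3⟩ := hT
    simp only [sample, Rand.vals_bind, Rand.vals_toRand, Rand.vals_pure, PMF.pure_bind,
      PMF.map_bind, PMF.pure_map, edges_append]
    have e := uniformOfFinset_bind_map_union T.pairings_nonempty U.pairings_nonempty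
      (fun a ha b hb a' ha' b' hb' hab => union_inj_of_isPairing h3
        (PairingTree.isPairing_of_mem_pairings h1 a ha)
        (PairingTree.isPairing_of_mem_pairings h1 a' ha')
        (PairingTree.isPairing_of_mem_pairings h2 b hb)
        (PairingTree.isPairing_of_mem_pairings h2 b' hb') hab)
      (PairingTree.pairings_nonempty (T.prod U))
    simp only [PairingTree.pairings]
    rw [← e, ← ihT h1, PMF.bind_map]
    congr 1
    funext p
    rw [Function.comp_apply, ← ihU h2, PMF.map_comp]
    rfl
  | union T U ihT ihU =>
    obtain ⟨h1, h2, h3, h4⟩ := hT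
    have hu : (T.union U).WellFormed := ⟨h1, h2, h3, h4⟩
    simp only [sample, Rand.vals_bind, Rand.vals_toRand, PMF.pure_bind, PMF.map_bind]
    have hcard : (T.union U).pairings.card = T.pairings.card + U.pairings.card :=
      Finset.card_union_of_disjoint h4
    rw [numPairings_val h1, numPairings_val hu, hcard]
    set a := T.pairings.card with ha
    set b := U.pairings.card with hb
    have ha0 : 0 < a := Finset.card_pos.2 T.pairings_nonempty
    have ha0' : (0 : ℝ) < a := by exact_mod_cast ha0
    have hb0' : (0 : ℝ) < b := by exact_mod_cast Finset.card_pos.2 U.pairings_nonempty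
    have hq0 : (0 : ℝ) ≤ a / (a + b : ℕ) := by positivity
    have hq1 : (a : ℝ) / (a + b : ℕ) ≤ 1 := by
      rw [div_le_one (by positivity)]; push_cast; linarith
    ext P
    rw [PMF.bind_apply, tsum_bool, uniformLt_vals_true hq1, uniformLt_vals_false hq0 hq1]
    simp only [if_true, Bool.false_eq_true, if_false, ihT h1, ihU h2]
    have hTP : P ∈ T.pairings → P ∉ U.pairings := fun h => Finset.disjoint_left.1 h4 h
    have hinv : ∀ k : ℕ, 0 < k → ((k : ENNReal))⁻¹ = ENNReal.ofReal ((k : ℝ)⁻¹) := fun k hk => by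
      rw [ENNReal.ofReal_inv_of_pos (by exact_mod_cast hk), ENNReal.ofReal_natCast]
    have hcard' : (T.pairings ∪ U.pairings).card = a + b := hcard
    have hb0 : 0 < b := Finset.card_pos.2 U.pairings_nonempty
    simp only [PMF.uniformOfFinset_apply, hcard', PairingTree.pairings, Finset.mem_union,
      ← ha, ← hb]
    rw [hinv a ha0, hinv b hb0, hinv (a + b) (by omega)]
    -- Left element: a/(a+b) · 1/a = 1/(a+b); the right side is symmetric, and disjointness prevents
    -- double counting.
    by_cases hP1 : P ∈ T.pairings
    · simp only [hP1, hTP hP1, if_true, if_false, mul_zero, zero_add, true_or]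
      rw [← ENNReal.ofReal_mul hq0]
      congr 1
      field_simp
    · by_cases hP2 : P ∈ U.pairings
      · simp only [hP1, hP2, if_true, if_false, mul_zero, add_zero, or_true]
        rw [← ENNReal.ofReal_mul (by linarith)]
        congr 1
        push_cast
        field_simp
        ring
      · simp [hP1, hP2]

/-- The probability that a random pairing represented by `U` is represented by `T`. -/
theorem sample_contains_prob (T U : PairingStructure n) :
    (sample U.tree).law.toMeasure {t | (contains T.tree t.val).val = true}
      = ENNReal.ofReal (overlap T U / overlap U U) := by
  -- The test is only meaningful for lists that are pairings of `[n]`, so the events are compared on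
  -- the support of the sampler.
  have e : {t : Timed (PairList n) | (contains T.tree t.val).val = true}
        ∩ (sample U.tree).law.support
      = ((edges ∘ Timed.val) ⁻¹' (T.tree.pairings : Set (Finset (Sym2 (Fin n)))))
        ∩ (sample U.tree).law.support := by
    ext t
    simp only [Set.mem_inter_iff, Set.mem_ofPred_eq, Set.mem_preimage, Function.comp_apply,
      Finset.mem_coe]
    refine and_congr_left fun ht => contains_val_iff T.wellFormed _ ?_
    rw [T.index_eq, ← U.index_eq]
    exact PairingTree.isPairing_of_mem_pairings U.wellFormed _
      (sample_support U.tree le_rfl t ht).1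
  rw [PMF.toMeasure_apply_eq_of_inter_support_eq _ MeasurableSpace.measurableSet_top
      MeasurableSpace.measurableSet_top e,
    PMF.toMeasure_apply_eq_toOuterMeasure_apply _ MeasurableSpace.measurableSet_top,
    ← PMF.toOuterMeasure_map_apply, ← PMF.map_comp, ← Rand.vals, sample_vals_map_edges U.wellFormed,
    PMF.toOuterMeasure_uniformOfFinset_apply]
  have hU := overlap_self_pos U
  rw [ENNReal.ofReal_div_of_pos hU, overlap, overlap, ENNReal.ofReal_natCast,
    ENNReal.ofReal_natCast, Finset.inter_self]
  congr 3
  ext P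
  simp [and_comm]

end Sampling

/-! ### The estimated correlation matrix -/

section Draws

variable {n m : ℕ}

instance (T : Fin m → PairingStructure n) : IsProbabilityMeasure (drawsLaw T) := by
  unfold drawsLaw; infer_instance

/-- The outcome, as a number, of testing a draw from `U` for membership in `T`. -/
noncomputable def testValue (T : PairingStructure n) (t : Timed (PairList n)) : ℝ :=
  if (contains T.tree t.val).val = true then 1 else 0

/-- The centered outcomes of all tests. -/
noncomputable def deviation (T : Fin m → PairingStructure n) (p : ℕ × (Fin m × Fin m))
    (ω : Draws n m) : ℝ :=
  testValue (T p.2.1) (ω (p.1 + 1, p.2.1, p.2.2))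
    - overlap (T p.2.1) (T p.2.2) / overlap (T p.2.2) (T p.2.2)

theorem testValue_mem_Icc (T : PairingStructure n) (t : Timed (PairList n)) :
    testValue T t ∈ Set.Icc (0 : ℝ) 1 := by
  unfold testValue; split_ifs <;> simp

theorem measurable_testValue (T : PairingStructure n) : Measurable (testValue T) :=
  fun _ _ => MeasurableSpace.measurableSet_top

theorem measurable_testValue_draw (T : Fin m → PairingStructure n) (p : ℕ × (Fin m × Fin m)) :
    Measurable fun ω : Draws n m => testValue (T p.2.1) (ω (p.1 + 1, p.2.1, p.2.2)) :=
  (measurable_testValue _).comp (measurable_pi_apply _)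

theorem measurable_deviation (T : Fin m → PairingStructure n) (p : ℕ × (Fin m × Fin m)) :
    Measurable (deviation T p) := (measurable_testValue_draw T p).sub_const _

theorem iIndepFun_deviation (T : Fin m → PairingStructure n) :
    iIndepFun (deviation T) (drawsLaw T) := by
  have h := iIndepFun_infinitePi
    (P := fun k : ℕ × Fin m × Fin m => (sample (T k.2.2).tree).law.toMeasure)
    (X := fun k t => testValue (T k.2.1) t
      - overlap (T k.2.1) (T k.2.2) / overlap (T k.2.2) (T k.2.2))
    fun k => (measurable_testValue _).sub_const _
  -- Rounds are numbered from 1 and partial sums from 0; the shifted index map is injective, so no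
  -- draw is used twice.
  refine h.precomp (g := fun p : ℕ × (Fin m × Fin m) => (p.1 + 1, p.2.1, p.2.2)) ?_
  rintro ⟨a, b, c⟩ ⟨a', b', c'⟩ hh
  simp only [Prod.mk.injEq, Nat.add_right_cancel_iff] at hh
  obtain ⟨rfl, rfl, rfl⟩ := hh
  rfl

theorem integral_testValue (T : Fin m → PairingStructure n) (p : ℕ × (Fin m × Fin m)) :
    ∫ ω, testValue (T p.2.1) (ω (p.1 + 1, p.2.1, p.2.2)) ∂drawsLaw T
      = overlap (T p.2.1) (T p.2.2) / overlap (T p.2.2) (T p.2.2) := by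
  have hmp := measurePreserving_eval_infinitePi
    (fun k : ℕ × Fin m × Fin m => (sample (T k.2.2).tree).law.toMeasure) (p.1 + 1, p.2.1, p.2.2)
  have e : ∀ ω : Draws n m, testValue (T p.2.1) (ω (p.1 + 1, p.2.1, p.2.2))
      = ({ω : Draws n m | (contains (T p.2.1).tree
          (ω (p.1 + 1, p.2.1, p.2.2)).val).val = true}).indicator 1 ω := by
    intro ω
    simp [testValue, Set.indicator_apply]
  have hms : MeasurableSet {t : Timed (PairList n) | (contains (T p.2.1).tree t.val).val = true} :=
    MeasurableSpace.measurableSet_top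
  have hms2 : MeasurableSet {ω : Draws n m |
      (contains (T p.2.1).tree (ω (p.1 + 1, p.2.1, p.2.2)).val).val = true} := hmp.measurable hms
  simp only [e]
  rw [integral_indicator_one hms2, measureReal_def, drawsLaw]
  have h2 := hmp.measure_preimage hms.nullMeasurableSet
  simp only [Set.preimage_ofPred_eq, Function.eval] at h2
  rw [h2, sample_contains_prob, ENNReal.toReal_ofReal]
  exact div_nonneg (Nat.cast_nonneg _) (Nat.cast_nonneg _)

theorem integral_deviation (T : Fin m → PairingStructure n) (p : ℕ × (Fin m × Fin m)) :
    ∫ ω, deviation T p ω ∂drawsLaw T = 0 := by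
  have hi : Integrable (fun ω : Draws n m => testValue (T p.2.1) (ω (p.1 + 1, p.2.1, p.2.2)))
      (drawsLaw T) := Integrable.of_mem_Icc 0 1 (measurable_testValue_draw T p).aemeasurable
        (ae_of_all _ fun ω => testValue_mem_Icc _ _)
  simp only [deviation]
  rw [integral_sub hi (integrable_const _), integral_testValue]
  simp

/-- Hoeffding's lemma on an interval of length 1: the proxy is (1/2)² = 1/4. -/
theorem hasSubgaussianMGF_deviation (T : Fin m → PairingStructure n) (p : ℕ × (Fin m × Fin m)) :
    HasSubgaussianMGF (deviation T p) (1 / 4) (drawsLaw T) := by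
  have h := hasSubgaussianMGF_of_mem_Icc (μ := drawsLaw T) (a := 0) (b := 1)
    (measurable_testValue_draw T p).aemeasurable (ae_of_all _ fun ω => testValue_mem_Icc _ _)
  rw [integral_testValue] at h
  have e : ((‖(1 : ℝ) - 0‖₊ / 2) ^ 2 : NNReal) = 1 / 4 := by
    rw [sub_zero, nnnorm_one, div_pow]
    norm_num
  rwa [e] at h

theorem abs_deviation_le (T : Fin m → PairingStructure n) (p : ℕ × (Fin m × Fin m))
    (ω : Draws n m) : |deviation T p ω| ≤ 1 := by
  have h1 := testValue_mem_Icc (T p.2.1) (ω (p.1 + 1, p.2.1, p.2.2))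
  have h2 : 0 ≤ overlap (T p.2.1) (T p.2.2) / overlap (T p.2.2) (T p.2.2) :=
    div_nonneg (Nat.cast_nonneg _) (Nat.cast_nonneg _)
  have h3 : overlap (T p.2.1) (T p.2.2) / overlap (T p.2.2) (T p.2.2) ≤ 1 := by
    rw [div_le_one (overlap_self_pos _), overlap, overlap, Finset.inter_self]
    exact_mod_cast Finset.card_le_card Finset.inter_subset_right
  rw [deviation, abs_le]
  exact ⟨by linarith [h1.1], by linarith [h1.2]⟩

theorem diagD_eq (T : Fin m → PairingStructure n) (i : Fin m) :
    diagD T i = √(overlap (T i) (T i)) := by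
  rw [diagD, numPairings_val (T i).wellFormed, overlap, Finset.inter_self]

theorem diagD_pos (T : Fin m → PairingStructure n) (i : Fin m) : 0 < diagD T i := by
  rw [diagD_eq]; exact Real.sqrt_pos.2 (overlap_self_pos _)

theorem diagD_sq (T : Fin m → PairingStructure n) (i : Fin m) :
    diagD T i ^ 2 = overlap (T i) (T i) := by
  rw [diagD_eq, Real.sq_sqrt (overlap_self_pos _).le]

theorem diagD_antitone {T : Fin m → PairingStructure n}
    (hT : ∀ i j : Fin m, i ≤ j → (T j).tree.pairings.card ≤ (T i).tree.pairings.card)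
    {i j : Fin m} (h : i ≤ j) : diagD T j ≤ diagD T i := by
  rw [diagD_eq, diagD_eq, overlap, overlap, Finset.inter_self, Finset.inter_self]
  exact Real.sqrt_le_sqrt (by exact_mod_cast hT i j h)

variable (q : Polynomial ℕ) (T : Fin m → PairingStructure n) (ω : Draws n m)

theorem loopState_val_diag (s : ℕ) (i : Fin m) : (loopState q T ω s).val i i = s := by
  induction s with
  | zero => rfl
  | succ s ih => simp [loopState, ih]

theorem loopState_val_of_ne (s : ℕ) {i j : Fin m} (h : i ≠ j) :
    ((loopState q T ω s).val i j : ℝ)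
      = ∑ r ∈ Finset.range s, testValue (T (min i j)) (ω (r + 1, min i j, max i j)) := by
  induction s with
  | zero => simp [loopState]
  | succ s ih =>
    rw [Finset.sum_range_succ, ← ih]
    simp only [loopState, h, false_or, hit, testValue]
    split_ifs <;> simp

theorem loopState_val_le (s : ℕ) (i j : Fin m) : (loopState q T ω s).val i j ≤ s := by
  induction s with
  | zero => simp [loopState]
  | succ s ih =>
    simp only [loopState]
    split_ifs <;> omega

theorem abs_estCorr_le
    (hT : ∀ i j : Fin m, i ≤ j → (T j).tree.pairings.card ≤ (T i).tree.pairings.card)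
    {s : ℕ} (hs : 0 < s) (i j : Fin m) : |estCorr q T ω s i j| ≤ 1 := by
  have hs' : (0 : ℝ) < s := by exact_mod_cast hs
  have h1 := diagD_pos T (min i j)
  have h2 := diagD_pos T (max i j)
  have h3 := diagD_antitone hT (min_le_max : min i j ≤ max i j)
  have h4 : ((loopState q T ω s).val i j : ℝ) ≤ s := by exact_mod_cast loopState_val_le q T ω s i j
  rw [estCorr, abs_of_nonneg (by positivity), div_le_one hs', mul_right_comm]
  refine (mul_le_of_le_one_left (Nat.cast_nonneg _) ?_).trans h4
  rwa [inv_mul_le_iff₀ h1, mul_one]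

/-- For a < b the error of the entry is d_b/d_a times the mean deviation, and d_b ≤ d_a by the
ordering: sampling from the smaller structure never amplifies noise. Diagonal entries are exact. -/
theorem sq_estCorr_sub_le
    (hT : ∀ i j : Fin m, i ≤ j → (T j).tree.pairings.card ≤ (T i).tree.pairings.card)
    {s : ℕ} (hs : 0 < s) (i j : Fin m) :
    (estCorr q T ω s - corrMatrix (gaussianWeights n) fun i => (T i).predictor) i j ^ 2
      ≤ (partialSum (fun p => deviation T p ω) s (min i j, max i j) / s) ^ 2 := by
  have hs' : (0 : ℝ) < s := by exact_mod_cast hs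
  have hsym : corrMatrix (gaussianWeights n) (fun i => (T i).predictor) i j
      = overlap (T (min i j)) (T (max i j)) / (diagD T (min i j) * diagD T (max i j)) := by
    rw [corrMatrix_predictor_apply, ← diagD_eq, ← diagD_eq]
    rcases le_total i j with h | h
    · rw [min_eq_left h, max_eq_right h]
    · rw [min_eq_right h, max_eq_left h, overlap_comm, mul_comm]
  rw [Matrix.sub_apply, hsym, estCorr]
  rcases eq_or_ne i j with rfl | hij
  · rw [loopState_val_diag, min_self, max_self, ← sq, diagD_sq]
    have h1 := (diagD_pos T i).ne'
    have h2 := (overlap_self_pos (T i)).ne'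
    have e : (diagD T i)⁻¹ * (s : ℝ) * diagD T i / s - overlap (T i) (T i) / overlap (T i) (T i)
        = 0 := by
      rw [div_self h2]; field_simp; simp
    rw [e]
    simp only [ne_eq, OfNat.ofNat_ne_zero, not_false_eq_true, zero_pow]
    positivity
  · rw [loopState_val_of_ne q T ω s hij]
    set a := min i j
    set b := max i j
    have ha := diagD_pos T a
    have hb := diagD_pos T b
    have hab := diagD_antitone hT (min_le_max : a ≤ b)
    have e : (diagD T a)⁻¹ * (∑ r ∈ Finset.range s, testValue (T a) (ω (r + 1, a, b)))
          * diagD T b / s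
        - overlap (T a) (T b) / (diagD T a * diagD T b)
        = diagD T b / diagD T a * (partialSum (fun p => deviation T p ω) s (a, b) / s) := by
      simp only [partialSum, deviation, Finset.sum_sub_distrib, Finset.sum_const,
        Finset.card_range, nsmul_eq_mul, ← diagD_sq T b]
      field_simp
    rw [e, mul_pow]
    refine mul_le_of_le_one_left (sq_nonneg _) ?_
    refine pow_le_one₀ (by positivity) ?_
    rwa [div_le_one ha]

/-- The factor 2 arises because the entries (i, j) and (j, i) read the same coordinate of the
deviation vector. -/
theorem sum_sq_estCorr_sub_le
    (hT : ∀ i j : Fin m, i ≤ j → (T j).tree.pairings.card ≤ (T i).tree.pairings.card)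
    {s : ℕ} (hs : 0 < s) :
    ∑ i, ∑ j, (estCorr q T ω s
        - corrMatrix (gaussianWeights n) fun i => (T i).predictor) i j ^ 2
      ≤ 2 * sqNormSum (fun p => deviation T p ω) s / (s : ℝ) ^ 2 := by
  set g : Fin m → Fin m → ℝ := fun i j =>
    (partialSum (fun p => deviation T p ω) s (i, j) / s) ^ 2 with hg
  have hg0 : ∀ i j, 0 ≤ g i j := fun i j => sq_nonneg _
  calc _ ≤ ∑ i, ∑ j, (g i j + g j i) := by
        refine Finset.sum_le_sum fun i _ => Finset.sum_le_sum fun j _ => ?_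
        refine (sq_estCorr_sub_le q T ω hT hs i j).trans ?_
        change g (min i j) (max i j) ≤ _
        rcases le_total i j with h | h
        · rw [min_eq_left h, max_eq_right h]; linarith [hg0 j i]
        · rw [min_eq_right h, max_eq_left h]; linarith [hg0 i j]
    _ = 2 * ∑ i, ∑ j, g i j := by
        simp only [Finset.sum_add_distrib]
        rw [Finset.sum_comm (f := fun i j => g j i)]
        ring
    _ = _ := by
        rw [sqNormSum, Fintype.sum_prod_type, mul_div_assoc, Finset.sum_div]
        simp only [hg, div_pow, Finset.sum_div]

end Draws

/-! ### Stopping and accuracy -/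

section Stopping

variable {n m : ℕ} {q : Polynomial ℕ} {T : Fin m → PairingStructure n} {ω : Draws n m}

/-- If the loop is left while the deviations are below the uniform bound, the output is
accurate. -/
theorem isApproxAccurate_of_stops (hm : 0 < m)
    (hT : ∀ i j : Fin m, i ≤ j → (T j).tree.pairings.card ≤ (T i).tree.pairings.card)
    {δ ε A : ℝ} (hε : 0 < ε) (hε1 : ε ≤ 2 / 5)
    (hA : A = 80 * ((m : ℝ) ^ 2 + 3 * Real.log (2 / δ))) {s : ℕ} (hs : Stops q T δ ε ω s)
    (hgood : A / ε ^ 2 ≤ s → sqNormSum (fun p => deviation T p ω) s ^ 2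
      < (25 / 98) ^ 2 * (s : ℝ) ^ 3 * A * (m : ℝ) ^ 2 * ε ^ 2) {f : (Edge n → ℝ) → ℝ}
    (hf : f = fun w => coeffs q T ω s ⬝ᵥ fun i => (T i).predictor w) :
    ∀ X ∈ ({fun _ => 1} ∪ Set.range (fun i => (T i).predictor) ∪ {f} : Set ((Edge n → ℝ) → ℝ)),
      IsApproxAccurate (gaussianWeights n) target ε X f := by
  obtain ⟨hs1, hpos, hle⟩ := hs
  have hs0 : (0 : ℝ) < s := by exact_mod_cast hs1
  set τ := leastSingularValue (estCorr q T ω s) with hτ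
  set Q := sqNormSum (fun p => deviation T p ω) s with hQ
  have hτm : τ ^ 2 ≤ m := leastSingularValue_sq_le_of_abs_le_one hm _
    fun i j => abs_estCorr_le q T ω hT hs1 i j
  have hle' : A * (m : ℝ) ^ 2 ≤ s * (ε ^ 2 * τ ^ 4) := by
    rw [div_le_iff₀ (by positivity)] at hle
    rw [hA]; linarith
  -- Since τ⁴ ≤ m², the stopping rule places s in the range where the uniform bound is available.
  have hAs : A / ε ^ 2 ≤ s := by
    rw [div_le_iff₀ (by positivity)]
    have h4 : τ ^ 4 ≤ (m : ℝ) ^ 2 := by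
      have := pow_le_pow_left₀ (sq_nonneg τ) hτm 2
      rwa [← pow_mul] at this
    have hm0 : (0 : ℝ) < (m : ℝ) ^ 2 := by positivity
    refine le_of_mul_le_mul_right (hle'.trans ?_) hm0
    calc s * (ε ^ 2 * τ ^ 4) ≤ s * (ε ^ 2 * (m : ℝ) ^ 2) := by gcongr
      _ = _ := by ring
  -- The constant is 25/98 = (5/7)²/2, so the factor 2 of `sum_sq_estCorr_sub_le` turns it into the
  -- error (5/7) ε τ.
  have hQ2 : Q ≤ 25 / 98 * (s : ℝ) ^ 2 * ε ^ 2 * τ ^ 2 := by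
    refine le_of_sq_le_sq ((hgood hAs).le.trans ?_) (by positivity)
    calc (25 / 98) ^ 2 * (s : ℝ) ^ 3 * A * (m : ℝ) ^ 2 * ε ^ 2
        = (25 / 98) ^ 2 * (s : ℝ) ^ 3 * ε ^ 2 * (A * (m : ℝ) ^ 2) := by ring
      _ ≤ (25 / 98) ^ 2 * (s : ℝ) ^ 3 * ε ^ 2 * (s * (ε ^ 2 * τ ^ 4)) := by gcongr
      _ = _ := by ring
  have hsum : ∑ i, ∑ j, (estCorr q T ω s
        - corrMatrix (gaussianWeights n) fun i => (T i).predictor) i j ^ 2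
      ≤ (5 / 7 * ε * τ) ^ 2 := by
    refine (sum_sq_estCorr_sub_le q T ω hT hs1).trans ?_
    rw [div_le_iff₀ (by positivity)]
    linarith
  have he0 : 0 ≤ 5 / 7 * ε * τ := by positivity
  have hσ := leastSingularValue_le_add hm _ _ he0 hsum
  refine isApproxAccurate_of_sum_sq_le hm T (estCorr q T ω s)
    (isUnit_det_of_leastSingularValue_pos hm _ hpos) he0 hε rfl ?_ hsum (diagD_eq T)
    (fun i => rfl) hf
  -- From τ ≤ σ + (5/7) ε τ and ε ≤ 2/5 follows (5/7) τ ≤ σ, where 1 − (5/7)(2/5) = 5/7.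
  rw [mul_comm (5 / 7 : ℝ), mul_assoc]
  refine mul_le_mul_of_nonneg_left ?_ hε.le
  rw [← hτ] at hσ
  nlinarith

/-- The loop is left once enough iterations are done and the deviations are small. -/
theorem stops_of_sqNormSum_lt (hm : 0 < m)
    (hT : ∀ i j : Fin m, i ≤ j → (T j).tree.pairings.card ≤ (T i).tree.pairings.card)
    {δ ε σ : ℝ} (hδ : 0 < δ) (hε : 0 < ε)
    (hσ : σ = leastSingularValue (corrMatrix (gaussianWeights n) fun i => (T i).predictor))
    (hσ0 : 0 < σ) {s : ℕ} (hs1 : 1 ≤ s)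
    (hs : 1280 * (m : ℝ) ^ 2 * ((m : ℝ) ^ 2 + 6 / δ) / (ε ^ 2 * σ ^ 4) ≤ s)
    (hQ : sqNormSum (fun p => deviation T p ω) s < σ ^ 2 * (s : ℝ) ^ 2 / 8) :
    Stops q T δ ε ω s := by
  have hs0 : (0 : ℝ) < s := by exact_mod_cast hs1
  set τ := leastSingularValue (estCorr q T ω s) with hτ
  have hsum : ∑ i, ∑ j, (corrMatrix (gaussianWeights n) (fun i => (T i).predictor)
      - estCorr q T ω s) i j ^ 2 ≤ (σ / 2) ^ 2 := by
    have h1 := sum_sq_estCorr_sub_le q T ω hT hs1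
    simp only [Matrix.sub_apply] at h1 ⊢
    have e : ∀ i j, (corrMatrix (gaussianWeights n) (fun i => (T i).predictor) i j
        - estCorr q T ω s i j) ^ 2 = (estCorr q T ω s i j
        - corrMatrix (gaussianWeights n) (fun i => (T i).predictor) i j) ^ 2 := fun i j => by ring
    simp only [e]
    refine h1.trans ?_
    rw [div_le_iff₀ (by positivity)]
    linarith
  have hστ := leastSingularValue_le_add hm _ _ (by positivity) hsum
  rw [← hσ, ← hτ] at hστ
  have hτ2 : σ / 2 ≤ τ := by linarith
  have hτ0 : 0 < τ := by linarith
  refine ⟨hs1, hτ0, ?_⟩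
  -- This replaces the logarithm by a polynomial in 1/δ; hence the 6/δ.
  have hlog : Real.log (2 / δ) ≤ 2 / δ := Real.log_le_self (by positivity)
  -- Replacing τ by σ/2 costs a factor 2⁴, and 1280 = 16 · 80.
  have hτ4 : (σ / 2) ^ 4 ≤ τ ^ 4 := by gcongr
  rw [div_le_iff₀ (by positivity)] at hs ⊢
  have e6 : 3 * (2 / δ) = 6 / δ := by ring
  calc 80 * (m : ℝ) ^ 2 * ((m : ℝ) ^ 2 + 3 * Real.log (2 / δ))
      ≤ 80 * (m : ℝ) ^ 2 * ((m : ℝ) ^ 2 + 6 / δ) := by rw [← e6]; gcongr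
    _ ≤ s * (ε ^ 2 * (σ / 2) ^ 4) := by
        have : s * (ε ^ 2 * (σ / 2) ^ 4) = s * (ε ^ 2 * σ ^ 4) / 16 := by ring
        rw [this]; linarith
    _ ≤ _ := by gcongr

/-- The number of iterations from `s₁` on with large deviations. -/
noncomputable def excess (T : Fin m → PairingStructure n) (σ : ℝ) (s₁ : ℕ) (ω : Draws n m) :
    ENNReal :=
  ∑' k : ℕ, {ω : Draws n m | σ ^ 2 * ((s₁ + k : ℕ) : ℝ) ^ 2 / 8
    ≤ sqNormSum (fun p => deviation T p ω) (s₁ + k)}.indicator (fun _ => (1 : ENNReal)) ω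

theorem measurableSet_large_deviation (T : Fin m → PairingStructure n) (σ : ℝ) (s : ℕ) :
    MeasurableSet {ω : Draws n m | σ ^ 2 * (s : ℝ) ^ 2 / 8
      ≤ sqNormSum (fun p => deviation T p ω) s} :=
  measurableSet_le measurable_const
    ((measurable_sqNormSum _).comp (measurable_pi_lambda _ (measurable_deviation T)))

theorem measurable_excess (T : Fin m → PairingStructure n) (σ : ℝ) (s₁ : ℕ) :
    Measurable (excess T σ s₁) :=
  Measurable.tsum fun _ =>
    measurable_const.indicator (measurableSet_large_deviation T σ _)

theorem lintegral_excess_le (T : Fin m → PairingStructure n) {σ : ℝ} (hσ0 : 0 < σ) {s₁ : ℕ}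
    (hs0 : 1 ≤ s₁) (hs2 : 8 * (m : ℝ) ^ 2 / σ ^ 2 ≤ s₁) :
    ∫⁻ ω, excess T σ s₁ ω ∂drawsLaw T ≤ ENNReal.ofReal (1 + 8 / σ ^ 2) := by
  unfold excess
  rw [lintegral_tsum fun k => (measurable_const.indicator
    (measurableSet_large_deviation T σ _)).aemeasurable]
  simp only [lintegral_indicator (measurableSet_large_deviation T σ _), lintegral_const, one_mul,
    Measure.restrict_apply MeasurableSet.univ, Set.univ_inter]
  exact tsum_measure_sqNormSum_ge_le (iIndepFun_deviation T) (measurable_deviation T)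
    (abs_deviation_le T) (integral_deviation T) (hasSubgaussianMGF_deviation T) hσ0 hs0 hs2

/-- The number of iterations is at most `s₁` plus the number of later iterations with large
deviations. -/
theorem numSamples_le_add_excess (hm : 0 < m)
    (hT : ∀ i j : Fin m, i ≤ j → (T j).tree.pairings.card ≤ (T i).tree.pairings.card)
    {δ ε σ : ℝ} (hδ : 0 < δ) (hε : 0 < ε)
    (hσ : σ = leastSingularValue (corrMatrix (gaussianWeights n) fun i => (T i).predictor))
    (hσ0 : 0 < σ) {s₁ : ℕ} (hs1 : 1 ≤ s₁)
    (hs : 1280 * (m : ℝ) ^ 2 * ((m : ℝ) ^ 2 + 6 / δ) / (ε ^ 2 * σ ^ 4) ≤ s₁) :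
    (match numSamples q T δ ε ω with
      | none => (⊤ : ENNReal)
      | some s => (s : ENNReal)) ≤ s₁ + excess T σ s₁ ω := by
  classical
  have hbad : ∀ k, ¬ Stops q T δ ε ω (s₁ + k) → ω ∈ {ω | σ ^ 2 * ((s₁ + k : ℕ) : ℝ) ^ 2 / 8
          ≤ sqNormSum (fun p => deviation T p ω) (s₁ + k)} := by
    intro k hk
    by_contra hc
    refine hk (stops_of_sqNormSum_lt hm hT hδ hε hσ hσ0 (by omega) (hs.trans ?_) (not_le.1 hc))
    push_cast
    linarith [(Nat.cast_nonneg k : (0 : ℝ) ≤ k)]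
  unfold numSamples
  split_ifs with h
  · simp only
    set s := Nat.find h with hsdef
    have hnot : ∀ k ∈ Finset.range (s - s₁), ¬ Stops q T δ ε ω (s₁ + k) := fun k hk =>
      Nat.find_min h (by rw [Finset.mem_range] at hk; omega)
    have h1 : ((s - s₁ : ℕ) : ENNReal) ≤ excess T σ s₁ ω := by
      refine le_trans ?_ (ENNReal.sum_le_tsum (Finset.range (s - s₁)))
      rw [Finset.sum_congr rfl fun k hk => Set.indicator_of_mem (hbad k (hnot k hk)) _]
      simp
    refine le_trans ?_ (add_le_add_right h1 _)
    exact_mod_cast (by omega : s ≤ s₁ + (s - s₁))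
  -- If the loop is never left, every term of the excess is 1 and the series diverges.
  · push Not at h
    simp only [excess]
    rw [tsum_congr fun k => Set.indicator_of_mem (hbad k (h _)) _]
    simp

end Stopping

/-! ### The running time -/

section RunningTime

variable {n m : ℕ} {q : Polynomial ℕ} {T : Fin m → PairingStructure n} {ω : Draws n m}

/-- A bound for the number of steps outside the loop. -/
def setupBound (q : Polynomial ℕ) (R : ℕ) : ℕ := 3 * R ^ 2 + 7 * R + 2 + q.eval R

/-- A bound for the number of steps of one iteration. -/
def roundBound (q : Polynomial ℕ) (R : ℕ) : ℕ :=
  R ^ 2 * (R * (4 * R + 4) + R * (3 + R * (4 * R + 4) + R * (2 * R + 2)) + 3)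
    + 4 * R ^ 2 + R + 21 + q.eval R

theorem rsize_le_sum (T : Fin m → PairingStructure n) (i : Fin m) :
    (T i).tree.rsize ≤ ∑ i, (T i).tree.rsize :=
  Finset.single_le_sum (f := fun i => (T i).tree.rsize) (fun _ _ => Nat.zero_le _)
    (Finset.mem_univ i)

theorem le_sum_rsize (T : Fin m → PairingStructure n) : m ≤ ∑ i, (T i).tree.rsize := by
  have := Finset.sum_le_sum (s := Finset.univ) fun (i : Fin m) _ => one_le_rsize (T i).tree
  simpa using this

theorem eval_nat_mono (q : Polynomial ℕ) {a b : ℕ} (h : a ≤ b) : q.eval a ≤ q.eval b := by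
  rw [Polynomial.eval_eq_sum, Polynomial.eval_eq_sum]
  exact Finset.sum_le_sum fun k _ => Nat.mul_le_mul_left _ (Nat.pow_le_pow_left h k)

/-- The steps after the loop are included on the left, so the bound transfers directly to the
running time. Draws must lie in the support of the sampler, where list lengths and sampling costs
are bounded. -/
theorem loopState_steps_le {R : ℕ} (hR : R = ∑ i, (T i).tree.rsize)
    (hω : ∀ k, ω k ∈ (sample (T k.2.2).tree).law.support) (s : ℕ) :
    (loopState q T ω s).steps + q.eval m + 2 * m ^ 2 + 3 * m + 1
      ≤ setupBound q R + s * roundBound q R := by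
  have hmR : m ≤ R := hR ▸ le_sum_rsize T
  have hq := eval_nat_mono q hmR
  have hm2 : m ^ 2 ≤ R ^ 2 := Nat.pow_le_pow_left hmR 2
  induction s with
  | zero =>
    have h1 : ∑ i, ((numPairings (T i).tree).steps + 2) ≤ 2 * R + 2 * m := by
      calc _ ≤ ∑ i, (2 * (T i).tree.rsize + 2) :=
            Finset.sum_le_sum fun i _ => Nat.add_le_add_right (numPairings_steps_le _) _
        _ = _ := by rw [Finset.sum_add_distrib, ← Finset.mul_sum, ← hR]; simp [mul_comm]
    simp only [loopState, setupBound]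
    omega
  | succ s ih =>
    set B := R * (4 * R + 4) + R * (3 + R * (4 * R + 4) + R * (2 * R + 2)) + 3 with hB
    have hij : ∀ i j, (ω (s + 1, i, j)).steps + (hit T ω (s + 1) i j).steps + 3 ≤ B := by
      intro i j
      have hjR : (T j).tree.rsize ≤ R := hR ▸ rsize_le_sum T j
      have hiR : (T i).tree.rsize ≤ R := hR ▸ rsize_le_sum T i
      obtain ⟨-, h2, h3⟩ := sample_support (T j).tree hjR _ (hω (s + 1, i, j))
      have h4 := contains_steps_le (T i).tree hiR _ (h2.trans hjR)
      have h5 := Nat.mul_le_mul_right (4 * R + 4) hjR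
      have h6 := Nat.mul_le_mul_right (3 + R * (4 * R + 4) + R * (2 * R + 2)) hiR
      simp only [hit]
      omega
    have h1 : ∑ i, (1 + ∑ j ∈ Finset.Ioi i,
        ((ω (s + 1, i, j)).steps + (hit T ω (s + 1) i j).steps + 3)) ≤ m + m ^ 2 * B := by
      calc _ ≤ ∑ i : Fin m, (1 + m * B) := by
            refine Finset.sum_le_sum fun i _ => Nat.add_le_add_left ?_ 1
            refine (Finset.sum_le_sum fun j _ => hij i j).trans ?_
            rw [Finset.sum_const, smul_eq_mul]
            exact Nat.mul_le_mul_right _ ((Finset.card_le_univ _).trans (by simp))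
        _ = _ := by simp; ring
    have h2 : m ^ 2 * B ≤ R ^ 2 * B := Nat.mul_le_mul_right _ hm2
    have h3 : (s + 1) * roundBound q R = s * roundBound q R
        + (R ^ 2 * B + 4 * R ^ 2 + R + 21 + q.eval R) := by rw [add_mul, one_mul]; rfl
    rw [h3]
    simp only [loopState]
    omega

theorem ae_mem_support (T : Fin m → PairingStructure n) :
    ∀ᵐ ω ∂drawsLaw T, ∀ k, ω k ∈ (sample (T k.2.2).tree).law.support := by
  rw [ae_all_iff]
  intro k
  have hmp := measurePreserving_eval_infinitePi
    (fun k : ℕ × Fin m × Fin m => (sample (T k.2.2).tree).law.toMeasure) k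
  have h : ∀ᵐ t ∂(sample (T k.2.2).tree).law.toMeasure,
      t ∈ (sample (T k.2.2).tree).law.support := by
    rw [ae_iff, PMF.toMeasure_apply_eq_zero_iff _ MeasurableSpace.measurableSet_top]
    exact Set.disjoint_left.2 fun t ht h => h ht
  exact hmp.quasiMeasurePreserving.ae h

theorem runtime_le {R : ℕ} (hR : R = ∑ i, (T i).tree.rsize) {δ ε : ℝ}
    (hω : ∀ k, ω k ∈ (sample (T k.2.2).tree).law.support) :
    runtime q T δ ε ω ≤ setupBound q R + roundBound q R *
      (match numSamples q T δ ε ω with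
        | none => (⊤ : ENNReal)
        | some s => (s : ENNReal)) := by
  unfold runtime
  cases numSamples q T δ ε ω with
  | none =>
    simp only
    -- The round bound is nonzero, so its product with ⊤ is ⊤.
    rw [ENNReal.mul_top (by simp [roundBound]), add_top]
  | some s =>
    simp only
    have := loopState_steps_le (q := q) hR hω s
    rw [mul_comm s] at this
    exact_mod_cast this

/-- Almost surely the time is affine in the number of rounds, which is at most s₁ plus an excess of
mean at most 1 + 8/σ². -/
theorem lintegral_runtime_le (hm : 0 < m)
    (hT : ∀ i j : Fin m, i ≤ j → (T j).tree.pairings.card ≤ (T i).tree.pairings.card)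
    {δ ε σ : ℝ} (hδ : 0 < δ) (hε : 0 < ε)
    (hσ : σ = leastSingularValue (corrMatrix (gaussianWeights n) fun i => (T i).predictor))
    (hσ0 : 0 < σ) {R : ℕ} (hR : R = ∑ i, (T i).tree.rsize) {s₁ : ℕ} (hs0 : 1 ≤ s₁)
    (hs1 : 1280 * (m : ℝ) ^ 2 * ((m : ℝ) ^ 2 + 6 / δ) / (ε ^ 2 * σ ^ 4) ≤ s₁)
    (hs2 : 8 * (m : ℝ) ^ 2 / σ ^ 2 ≤ s₁) :
    ∫⁻ ω, runtime q T δ ε ω ∂drawsLaw T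
      ≤ setupBound q R + roundBound q R * (s₁ + ENNReal.ofReal (1 + 8 / σ ^ 2)) := by
  have hae : ∀ᵐ ω ∂drawsLaw T, runtime q T δ ε ω
      ≤ setupBound q R + roundBound q R * (s₁ + excess T σ s₁ ω) := by
    filter_upwards [ae_mem_support T] with ω hω
    refine (runtime_le hR hω).trans ?_
    gcongr
    exact numSamples_le_add_excess hm hT hδ hε hσ hσ0 hs0 hs1
  refine (lintegral_mono_ae hae).trans ?_
  rw [lintegral_add_left measurable_const, lintegral_const_mul' _ _ (ENNReal.natCast_ne_top _),
    lintegral_add_left measurable_const]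
  simp only [lintegral_const, measure_univ, mul_one]
  gcongr
  exact lintegral_excess_le T hσ0 hs0 hs2

/-- The loop is left almost surely. -/
theorem measure_numSamples_eq_none (hm : 0 < m)
    (hT : ∀ i j : Fin m, i ≤ j → (T j).tree.pairings.card ≤ (T i).tree.pairings.card)
    {δ ε σ : ℝ} (hδ : 0 < δ) (hε : 0 < ε)
    (hσ : σ = leastSingularValue (corrMatrix (gaussianWeights n) fun i => (T i).predictor))
    (hσ0 : 0 < σ) {s₁ : ℕ} (hs0 : 1 ≤ s₁)
    (hs1 : 1280 * (m : ℝ) ^ 2 * ((m : ℝ) ^ 2 + 6 / δ) / (ε ^ 2 * σ ^ 4) ≤ s₁)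
    (hs2 : 8 * (m : ℝ) ^ 2 / σ ^ 2 ≤ s₁) :
    drawsLaw T {ω | numSamples q T δ ε ω = none} = 0 := by
  have h := ae_lt_top (measurable_excess T σ s₁)
    (ne_top_of_le_ne_top ENNReal.ofReal_ne_top (lintegral_excess_le T hσ0 hs0 hs2))
  refine measure_mono_null (fun ω hω => ?_) (ae_iff.1 h)
  have h2 := numSamples_le_add_excess (q := q) (ω := ω) hm hT hδ hε hσ hσ0 hs0 hs1
  rw [Set.mem_ofPred_eq] at hω
  simp only [hω, top_le_iff, ENNReal.add_eq_top, ENNReal.natCast_ne_top, false_or] at h2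
  simp [h2]

end RunningTime

/-! ### Failure probability and the polynomial bound. -/

section Main

variable {n m : ℕ} {q : Polynomial ℕ} {T : Fin m → PairingStructure n}

theorem isAlgMultiaccurate_estimatorOutput (hm : 0 < m)
    (hT : ∀ i j : Fin m, i ≤ j → (T j).tree.pairings.card ≤ (T i).tree.pairings.card)
    {δ ε : ℝ} (hδ : 0 < δ) (hε : 0 < ε) (hε1 : ε ≤ 2 / 5)
    (hnone : drawsLaw T {ω | numSamples q T δ ε ω = none} = 0) :
    IsAlgMultiaccurate (gaussianWeights n) target (drawsLaw T) (estimatorOutput q T δ ε) δ ε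
      (fun f => {fun _ => 1} ∪ Set.range (fun i => (T i).predictor) ∪ {f}) := by
  -- For δ ≥ 1 nothing is claimed; otherwise L = log(2/δ) is positive, as the uniform bound
  -- requires.
  rcases le_or_gt 1 δ with hδ1 | hδ1
  · rw [IsAlgMultiaccurate, ENNReal.ofReal_of_nonpos (by linarith)]
    exact zero_le
  set L := Real.log (2 / δ) with hL
  set A := 80 * ((m : ℝ) ^ 2 + 3 * L) with hA
  have hL0 : 0 < L := Real.log_pos (by rw [lt_div_iff₀ hδ]; linarith)
  have hexp : 2 * Real.exp (-L) = δ := by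
    rw [hL, Real.exp_neg, Real.exp_log (by positivity)]; field_simp
  set bad : Set (Draws n m) := {ω | ∃ s : ℕ, A / ε ^ 2 ≤ s ∧
        (25 / 98) ^ 2 * (s : ℝ) ^ 3 * A * (m : ℝ) ^ 2 * ε ^ 2
          ≤ sqNormSum (fun p => deviation T p ω) s ^ 2} with hbad
  have hb : drawsLaw T bad ≤ ENNReal.ofReal δ := by
    have := measure_exists_sq_sqNormSum_ge_le (iIndepFun_deviation T) (measurable_deviation T)
      (abs_deviation_le T) (integral_deviation T) (hasSubgaussianMGF_deviation T) hm hε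
      (by linarith) hL0 hA
    rwa [hexp] at this
  set good : Set (Draws n m) := {r | ∃ f, estimatorOutput q T δ ε r = some f ∧
    ∀ X ∈ ({fun _ => 1} ∪ Set.range (fun i => (T i).predictor) ∪ {f} : Set ((Edge n → ℝ) → ℝ)),
      IsApproxAccurate (gaussianWeights n) target ε X f} with hgood
  have hcover : Set.univ ⊆ good ∪ (bad ∪ {ω | numSamples q T δ ε ω = none}) := by
    intro ω _
    by_cases h1 : numSamples q T δ ε ω = none
    · exact Or.inr (Or.inr h1)
    by_cases h2 : ω ∈ bad
    · exact Or.inr (Or.inl h2)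
    left
    obtain ⟨s, hs⟩ := Option.ne_none_iff_exists'.1 h1
    have hleave : Stops q T δ ε ω s := by
      unfold numSamples at hs
      split_ifs at hs with h
      classical
      rw [Option.some.injEq] at hs
      rw [← hs]
      exact Nat.find_spec h
    refine ⟨fun w => coeffs q T ω s ⬝ᵥ fun i => (T i).predictor w, ?_, ?_⟩
    · simp [estimatorOutput, estimator, hs]
    · refine isApproxAccurate_of_stops hm hT hε hε1 hA hleave (fun hAs => ?_) rfl
      by_contra hc
      exact h2 ⟨s, hAs, not_lt.1 hc⟩
  -- Subadditivity holds for arbitrary sets, so measurability of the success event is not needed.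
  have h1 : (1 : ENNReal) ≤ drawsLaw T good + ENNReal.ofReal δ := by
    calc (1 : ENNReal) = drawsLaw T Set.univ := measure_univ.symm
      _ ≤ drawsLaw T good + (drawsLaw T bad + drawsLaw T {ω | numSamples q T δ ε ω = none}) :=
          (measure_mono hcover).trans ((measure_union_le _ _).trans
            (add_le_add_right (measure_union_le _ _) _))
      _ ≤ _ := by rw [hnone, add_zero]; gcongr
  rw [IsAlgMultiaccurate, ENNReal.ofReal_sub _ hδ.le, ENNReal.ofReal_one]
  exact tsub_le_iff_right.2 h1

/-- A polynomial with natural coefficients, evaluated at the fourth variable. -/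
noncomputable def sizePoly (q : Polynomial ℕ) : MvPolynomial (Fin 4) ℝ :=
  ∑ k ∈ q.support, MvPolynomial.C (q.coeff k : ℝ) * MvPolynomial.X 3 ^ k

theorem eval_sizePoly (q : Polynomial ℕ) (x : Fin 4 → ℝ) {R : ℕ} (hR : x 3 = R) :
    MvPolynomial.eval x (sizePoly q) = (q.eval R : ℕ) := by
  simp [sizePoly, Polynomial.eval_eq_sum, Polynomial.sum, hR]

open MvPolynomial in
/-- A bound for the expected running time. -/
noncomputable def runtimePoly (q : Polynomial ℕ) : MvPolynomial (Fin 4) ℝ :=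
  (3 * X 3 ^ 2 + 7 * X 3 + 2 + sizePoly q)
    + (X 3 ^ 2 * (X 3 * (4 * X 3 + 4) + X 3 * (3 + X 3 * (4 * X 3 + 4) + X 3 * (2 * X 3 + 2)) + 3)
      + 4 * X 3 ^ 2 + X 3 + 21 + sizePoly q)
      * (1280 * X 3 ^ 2 * (X 3 ^ 2 + 6 * X 0) * X 1 ^ 2 * X 2 ^ 4 + 8 * X 3 ^ 2 * X 2 ^ 2
        + 3 + 8 * X 2 ^ 2)

theorem eval_runtimePoly (q : Polynomial ℕ) (δ ε σ : ℝ) (R : ℕ) :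
    MvPolynomial.eval ![1 / δ, 1 / ε, 1 / σ, (R : ℝ)] (runtimePoly q)
      = setupBound q R + roundBound q R *
        (1280 * (R : ℝ) ^ 2 * ((R : ℝ) ^ 2 + 6 / δ) / (ε ^ 2 * σ ^ 4)
          + 8 * (R : ℝ) ^ 2 / σ ^ 2 + 3 + 8 / σ ^ 2) := by
  have h := eval_sizePoly q ![1 / δ, 1 / ε, 1 / σ, (R : ℝ)] (R := R) rfl
  simp only [runtimePoly, map_add, map_mul, map_pow, map_ofNat, MvPolynomial.eval_X, h, setupBound,
    roundBound]
  push_cast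
  ring

end Main

end HafnianMerge

theorem mainTheorem2 (q : Polynomial ℕ) :
    ∃ P : MvPolynomial (Fin 4) ℝ,
      ∀ (n m : ℕ) (T : Fin m → HafnianMerge.PairingStructure n) (δ ε σ : ℝ),
        0 < m →
        (∀ i j : Fin m, i ≤ j → (T j).tree.pairings.card ≤ (T i).tree.pairings.card) →
        0 < δ → 0 < ε →
        σ = HafnianMerge.leastSingularValue
          (HafnianMerge.corrMatrix (HafnianMerge.gaussianWeights n) fun i => (T i).predictor) →
        0 < σ →
        (ε ≤ 2 / 5 →
          HafnianMerge.IsAlgMultiaccurate (HafnianMerge.gaussianWeights n) HafnianMerge.target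
            (HafnianMerge.drawsLaw T) (HafnianMerge.estimatorOutput q T δ ε) δ ε
            (fun f => {fun _ => 1} ∪ Set.range (fun i => (T i).predictor) ∪ {f})) ∧
        ∫⁻ ω, HafnianMerge.runtime q T δ ε ω ∂(HafnianMerge.drawsLaw T) ≤
          ENNReal.ofReal (MvPolynomial.eval
            ![1 / δ, 1 / ε, 1 / σ, ((∑ i, (T i).tree.rsize : ℕ) : ℝ)] P) := by
  refine ⟨HafnianMerge.runtimePoly q, fun n m T δ ε σ hm hT hδ hε hσ hσ0 => ?_⟩
  set R := ∑ i, (T i).tree.rsize with hR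
  have hmR : (m : ℝ) ≤ R := by exact_mod_cast HafnianMerge.le_sum_rsize T
  set B₁ := 1280 * (R : ℝ) ^ 2 * ((R : ℝ) ^ 2 + 6 / δ) / (ε ^ 2 * σ ^ 4) with hB₁
  set B₂ := 8 * (R : ℝ) ^ 2 / σ ^ 2 with hB₂
  have hB1 : 0 ≤ B₁ := by positivity
  have hB2 : 0 ≤ B₂ := by positivity
  have hceil := Nat.le_ceil (1 + B₁ + B₂)
  have hceil2 := Nat.ceil_lt_add_one (a := 1 + B₁ + B₂) (by positivity)
  have hs0 : 1 ≤ ⌈1 + B₁ + B₂⌉₊ := Nat.one_le_ceil_iff.2 (by positivity)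
  have hs1 : 1280 * (m : ℝ) ^ 2 * ((m : ℝ) ^ 2 + 6 / δ) / (ε ^ 2 * σ ^ 4)
      ≤ (⌈1 + B₁ + B₂⌉₊ : ℝ) := by
    -- The threshold is stated with R in place of m, which is legitimate as m ≤ R, so that the bound
    -- depends only on the four allowed quantities.
    refine le_trans ?_ (show B₁ ≤ _ by linarith)
    rw [hB₁]
    gcongr
  have hs2 : 8 * (m : ℝ) ^ 2 / σ ^ 2 ≤ (⌈1 + B₁ + B₂⌉₊ : ℝ) := by
    refine le_trans ?_ (show B₂ ≤ _ by linarith)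
    rw [hB₂]
    gcongr
  refine ⟨fun hε1 => HafnianMerge.isAlgMultiaccurate_estimatorOutput hm hT hδ hε hε1
    (HafnianMerge.measure_numSamples_eq_none hm hT hδ hε hσ hσ0 hs0 hs1 hs2), ?_⟩
  refine (HafnianMerge.lintegral_runtime_le hm hT hδ hε hσ hσ0 hR hs0 hs1 hs2).trans ?_
  rw [HafnianMerge.eval_runtimePoly]
  have hσ8 : 0 ≤ 8 / σ ^ 2 := by positivity
  have e : (HafnianMerge.setupBound q R : ENNReal) + HafnianMerge.roundBound q R
        * (⌈1 + B₁ + B₂⌉₊ + ENNReal.ofReal (1 + 8 / σ ^ 2))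
      = ENNReal.ofReal (HafnianMerge.setupBound q R + HafnianMerge.roundBound q R
        * (⌈1 + B₁ + B₂⌉₊ + (1 + 8 / σ ^ 2))) := by
    rw [ENNReal.ofReal_add (p := (HafnianMerge.setupBound q R : ℝ)) (by positivity)
        (by positivity), ENNReal.ofReal_mul (by positivity),
      ENNReal.ofReal_add (p := (⌈1 + B₁ + B₂⌉₊ : ℝ)) (by positivity) (by positivity)]
    simp only [ENNReal.ofReal_natCast]
  rw [e]
  refine ENNReal.ofReal_le_ofReal
    (add_le_add le_rfl (mul_le_mul_of_nonneg_left ?_ (Nat.cast_nonneg _)))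
  -- The ceiling is below 2 + B₁ + B₂; with the 1 from the excess this gives the constant 3 in
  -- `runtimePoly`.
  rw [← hB₁, ← hB₂]
  linarith
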